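/- **Conventions.** For a real or complex Banach space $\mathfrak b$, a *Banach Lie-Poisson structure* on $\mathfrak b$ is a Lie bracket $\{\cdot,\cdot\}$ on $C^\infty(\mathfrak b)$ (scalar-valued smooth functions; holomorphic ones if the scalars are $\mathbb C$) which satisfies the Leibniz rule, for which every derivation $\{\cdot,h\}$ is given by a smooth vector field $X_h$ on $\mathfrak b$, and for which $\mathfrak b^*\subset C^\infty(\mathfrak b)$ is closed under the bracket and is a Banach Lie algebra. Let $\mathfrak m$ be a $W^*$-algebra with predual $\mathfrak m_*$ (so $\mathfrak m=(\mathfrak m_*)^*$), a Lie algebra under the commutator, let $\mathcal H$ be a complex Hilbert space, and let $\varphi:\mathfrak m\to L^\infty(\mathcal H)$ be a $W^*$-representation, i.e. a $*$-homomorphism into the bounded operators that is continuous for $\sigma(\mathfrak m,\mathfrak m_*)$ and $\sigma(L^\infty(\mathcal H),L^1(\mathcal H))$, where $L^1(\mathcal H)$ denotes the trace class operators. The inner product $\langle\cdot\,|\,\cdot\rangle$ is antilinear in its first argument. $\mathcal H$ is regarded as an Abelian Lie algebra and as its own dual and predual, in either of two ways: (ℂ) as complex spaces, where $v\in\mathcal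 H$ as an element of the predual is identified with the functional $\langle v|\,\cdot\,\rangle\in\mathcal H^*$ and the pairing is $\langle \zeta, v\rangle:=\langle v|\zeta\rangle$ for $\zeta\in\mathcal H$; (ℝ) as real spaces, all pairings (also the one between $\mathfrak m$ and $\mathfrak m_*$) being replaced by their real parts. For $f\in C^\infty(\mathcal H\oplus\mathfrak m_*)$ let $\frac{\delta f}{\delta v}\in\mathcal H$ and $\frac{\delta f}{\delta b}\in\mathfrak m$ be the elements representing the partial Fréchet derivatives of $f$ through these pairings. **Statement.** In both settings the following holds. 1. $\varphi$ is a continuous representation of the Banach Lie algebra $\mathfrak m$ on $\mathcal H$. For all $v,w\in\mathcal H$ there is $b\in\mathfrak m_*$ with $\langle w|\varphi(x)v\rangle=\langle x,b\rangle$ for all $x\in\mathfrak m$, and the semidirect product conditions hold: for all $x\in\mathfrak m$, $\zeta\in\mathcal H$, the dual map $\varphi(x)^*$ preserves the predual $\mathcal H$, and $(\varphi(\cdot)\zeta)^*$ maps the predual $\mathcal H$ into $\mathfrak m_*$. 2. There is exactly one Banach Lie-Poisson structure on $\mathcal H\oplus\mathfrak m_*$ making it the semidirect product Banach Lie-Poisson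 space of $\mathfrak m_*$ with $\mathcal H$. That is: its dual Banach Lie algebra is $\mathcal H\oplus\mathfrak m$ with $[(\zeta,\eta),(\zeta',\eta')]=(\varphi(\eta)\zeta'-\varphi(\eta')\zeta,\,[\eta,\eta'])$; for smooth $f,g$, $$\{f,g\}(v,b)=\Big\langle\Big[\frac{\delta f}{\delta b},\frac{\delta g}{\delta b}\Big],b\Big\rangle+\Big\langle\varphi\Big(\frac{\delta f}{\delta b}\Big)\frac{\delta g}{\delta v}-\varphi\Big(\frac{\delta g}{\delta b}\Big)\frac{\delta f}{\delta v},\,v\Big\rangle;$$ and the Hamiltonian vector field of a smooth $h$ is $$X_h(v,b)=-\Big(\varphi\Big(\frac{\delta h}{\delta b}\Big)^*v,\;-\Big(\varphi(\cdot)\frac{\delta h}{\delta v}\Big)^*v+\operatorname{ad}^*_{\delta h/\delta b}\,b\Big).$$ 3. Let $\mathfrak m=L^\infty(\mathcal H)$, with its identity representation (which is a $W^*$-representation). Then $L^1(\mathcal H)$ with the trace norm is a Banach space, and it is the predual of $L^\infty(\mathcal H)$ through the isometric pairing $\langle A,\rho\rangle=\operatorname{tr}(\rho A)$, the trace being computable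 in any orthonormal basis. The structure of part 2 on $\mathcal H\oplus L^1(\mathcal H)$ is $$\{f,g\}(v,\rho)=\operatorname{tr}\Big(\rho\Big[\frac{\delta f}{\delta\rho},\frac{\delta g}{\delta\rho}\Big]\Big)+\Big\langle v\,\Big|\,\frac{\delta f}{\delta\rho}\frac{\delta g}{\delta v}-\frac{\delta g}{\delta\rho}\frac{\delta f}{\delta v}\Big\rangle$$ (the real part of this expression in the real setting). For every smooth Hamiltonian $h$ on $\mathcal H\oplus L^1(\mathcal H)$ and every curve $t\mapsto(v(t),\rho(t))$ of the real variable $t$ differentiable at $t$, Hamilton's equation $\dot f=\{f,h\}$ at $t$ for all smooth $f$ is equivalent to $$\dot v=-\Big(\frac{\delta h}{\delta\rho}\Big)^*v,\qquad \dot\rho=\Big[\frac{\delta h}{\delta\rho},\rho\Big]+\Big|\frac{\delta h}{\delta v}\Big\rangle\langle v|,$$ where $(\cdot)^*$ is the Hilbert space adjoint. -/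

import Mathlib

open scoped ContDiff Topology

noncomputable section

/-! ## Banach Poisson structures and Banach Lie-Poisson spaces -/

section Poisson

variable (𝕜 : Type*) [RCLike 𝕜] (E : Type*) [NormedAddCommGroup E] [NormedSpace 𝕜 E]

/-- The algebra `C^∞(E)` of `𝕜`-valued smooth functions on the `𝕜`-normed space `E`
(smooth over `ℝ`, holomorphic over `ℂ`), with pointwise operations. -/
def SmoothFun : Subalgebra 𝕜 (E → 𝕜) where
  carrier := {f | ContDiff 𝕜 ∞ f}
  mul_mem' {f g} hf hg := by
    simp only [Set.mem_ofPred_eq] at hf hg ⊢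
    exact hf.mul hg
  add_mem' {f g} hf hg := by
    simp only [Set.mem_ofPred_eq] at hf hg ⊢
    exact hf.add hg
  algebraMap_mem' r := (contDiff_const : ContDiff 𝕜 ∞ fun _ : E => r)

variable {𝕜 E}

/-- A continuous linear functional, regarded as a smooth function. -/
def SmoothFun.ofDual (ℓ : StrongDual 𝕜 E) : SmoothFun 𝕜 E :=
  ⟨fun x => ℓ x, (ℓ.contDiff : ContDiff 𝕜 ∞ fun x => ℓ x)⟩

variable (𝕜 E)

/-- A Banach Poisson structure on the `𝕜`-Banach space `E`, considered as a manifold: a Lie bracket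
on `C^∞(E)` satisfying the Leibniz rule and such that every derivation `{·, h}` is given by a
smooth vector field on `E`. -/
@[ext]
structure PoissonStructure where
  bracket : SmoothFun 𝕜 E →ₗ[𝕜] SmoothFun 𝕜 E →ₗ[𝕜] SmoothFun 𝕜 E
  bracket_self : ∀ f, bracket f f = 0
  jacobi : ∀ f g h,
    bracket f (bracket g h) + bracket g (bracket h f) + bracket h (bracket f g) = 0
  leibniz : ∀ f g h, bracket (f * g) h = f * bracket g h + bracket f h * g
  exists_vectorField : ∀ h, ∃ X : E → E, ContDiff 𝕜 ∞ X ∧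
    ∀ (f : SmoothFun 𝕜 E) (x : E), (bracket f h).1 x = fderiv 𝕜 f.1 x (X x)

variable {𝕜 E}

/-- The Poisson structure is Lie-Poisson: the dual space, as a subspace of `C^∞(E)`, is closed
under the Poisson bracket and is a Banach Lie algebra (i.e. the bracket is continuous for the norm
of the dual). -/
def PoissonStructure.IsLiePoisson (P : PoissonStructure 𝕜 E) : Prop :=
  ∃ B : StrongDual 𝕜 E →L[𝕜] StrongDual 𝕜 E →L[𝕜] StrongDual 𝕜 E,
    ∀ x y, P.bracket (SmoothFun.ofDual x) (SmoothFun.ofDual y) = SmoothFun.ofDual (B x y)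

end Poisson

/-! ## Semidirect products with an Abelian ideal

Here `n` and `h` are Banach spaces with preduals `c` and `a`: the identifications of `n`, `h` with
the dual spaces of `c`, `a` are `κ`, `ε`, so that `κ ζ v` is the duality pairing `⟨ζ, v⟩`. The space
`n` is an Abelian Lie algebra and `h` an associative Banach algebra with its commutator bracket. -/

section Semidirect

variable {𝕜 : Type*} [RCLike 𝕜]
  {n c h a : Type*} [NormedAddCommGroup n] [NormedSpace 𝕜 n]
  [NormedAddCommGroup c] [NormedSpace 𝕜 c] [NormedRing h] [NormedAlgebra 𝕜 h]
  [NormedAddCommGroup a] [NormedSpace 𝕜 a]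

variable (𝕜) in
/-- `φ` is a continuous representation of the Banach Lie algebra `h` (with the commutator bracket)
by bounded linear operators on `n`. -/
structure IsLieRepresentation (φ : h → n → n) : Prop where
  bounded : IsBoundedBilinearMap 𝕜 fun p : h × n => φ p.1 p.2
  map_lie : ∀ η η' ζ, φ ⁅η, η'⁆ ζ = φ η (φ η' ζ) - φ η' (φ η ζ)

/-- The semidirect product conditions: `φ(η)^* c ⊆ c` for all `η`, and `(φ(·)ζ)^* c ⊆ a` for
all `ζ`. -/
structure SemidirectConditions (κ : n ≃ₗᵢ[𝕜] StrongDual 𝕜 c) (ε : h ≃ₗᵢ[𝕜] StrongDual 𝕜 a)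
    (φ : h → n → n) : Prop where
  left : ∀ (η : h) (v : c), ∃ v' : c, ∀ ζ : n, κ (φ η ζ) v = κ ζ v'
  right : ∀ (ζ : n) (v : c), ∃ b : a, ∀ η : h, κ (φ η ζ) v = ε η b

/-- The partial functional derivative `δf/δc ∈ n` at a point of `c × a`. -/
def derivFst (κ : n ≃ₗᵢ[𝕜] StrongDual 𝕜 c) (f : SmoothFun 𝕜 (c × a)) (z : c × a) : n :=
  κ.symm (fderiv 𝕜 (fun v => f.1 (v, z.2)) z.1)

/-- The partial functional derivative `δf/δa ∈ h` at a point of `c × a`. -/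
def derivSnd (ε : h ≃ₗᵢ[𝕜] StrongDual 𝕜 a) (f : SmoothFun 𝕜 (c × a)) (z : c × a) : h :=
  ε.symm (fderiv 𝕜 (fun b => f.1 (z.1, b)) z.2)

/-- The functional on `c × a` given by an element `(ζ, η)` of `n × h`. -/
def pairDual (κ : n ≃ₗᵢ[𝕜] StrongDual 𝕜 c) (ε : h ≃ₗᵢ[𝕜] StrongDual 𝕜 a) (ζ : n) (η : h) :
    StrongDual 𝕜 (c × a) :=
  (κ ζ).coprod (ε η)

/-- The Poisson structure `P` makes `c × a` the semidirect product Banach Lie-Poisson space of `a`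
with `c` (where `n` is Abelian):
* `c × a` is a Banach Lie-Poisson space whose dual Lie algebra is the semidirect product `n × h`
  with bracket `[(ζ, η), (ζ', η')] = (φ(η)ζ' - φ(η')ζ, [η, η'])`;
* the bracket of smooth functions is given by the semidirect product formula;
* the Hamiltonian vector field of `H` is
  `-(φ(δH/δa)^* v, -(φ(·) δH/δc)^* v + ad^*_{δH/δa} b)` at `(v, b)`, each component being
  described by its pairings with all elements of `n`, respectively `h`. -/
structure IsSemidirectLiePoisson (κ : n ≃ₗᵢ[𝕜] StrongDual 𝕜 c) (ε : h ≃ₗᵢ[𝕜] StrongDual 𝕜 a)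
    (φ : h → n → n) (P : PoissonStructure 𝕜 (c × a)) : Prop where
  liePoisson : P.IsLiePoisson
  bracket_dual : ∀ (ζ : n) (η : h) (ζ' : n) (η' : h),
    P.bracket (SmoothFun.ofDual (pairDual κ ε ζ η)) (SmoothFun.ofDual (pairDual κ ε ζ' η')) =
      SmoothFun.ofDual (pairDual κ ε (φ η ζ' - φ η' ζ) ⁅η, η'⁆)
  bracket_eq : ∀ (f g : SmoothFun 𝕜 (c × a)) (z : c × a), (P.bracket f g).1 z =
    ε ⁅derivSnd ε f z, derivSnd ε g z⁆ z.2 +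
      κ (φ (derivSnd ε f z) (derivFst κ g z) - φ (derivSnd ε g z) (derivFst κ f z)) z.1
  vectorField : ∀ H : SmoothFun 𝕜 (c × a), ∃ X : c × a → c × a, ContDiff 𝕜 ∞ X ∧
    (∀ (f : SmoothFun 𝕜 (c × a)) (z : c × a), (P.bracket f H).1 z = fderiv 𝕜 f.1 z (X z)) ∧
    ∀ z : c × a,
      (∀ ζ : n, κ ζ (X z).1 = -κ (φ (derivSnd ε H z) ζ) z.1) ∧
      ∀ η : h, ε η (X z).2 = κ (φ η (derivFst κ H z)) z.1 - ε ⁅derivSnd ε H z, η⁆ z.2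

end Semidirect

/-! ## Duality pairings over `ℂ` and over `ℝ` -/

section Pairings

variable (H : Type*) [NormedAddCommGroup H] [InnerProductSpace ℂ H] [CompleteSpace H]

/-- A complex Hilbert space as the dual of the space of its bounded linear functionals:
`hilbertBidual H ζ ℓ = ℓ ζ`. -/
def hilbertBidual : H ≃ₗᵢ[ℂ] StrongDual ℂ (StrongDual ℂ H) :=
  LinearIsometryEquiv.ofSurjective (NormedSpace.inclusionInDoubleDualLi ℂ) (by
    intro Φ
    let J := InnerProductSpace.toDual ℂ H
    let ψ : StrongDual ℂ H :=
      { toFun := fun v => starRingEnd ℂ (Φ (J v))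
        map_add' := by intro x y; simp
        map_smul' := by
          intro r x
          rw [map_smulₛₗ J, map_smul]; simp
        cont := by
          have : Continuous fun v => Φ (J v) := Φ.continuous.comp J.continuous
          exact Complex.continuous_conj.comp this }
    refine ⟨J.symm ψ, ?_⟩
    ext ℓ
    obtain ⟨v, rfl⟩ := J.surjective ℓ
    change J v (J.symm ψ) = Φ (J v)
    rw [InnerProductSpace.toDual_apply_apply, ← inner_conj_symm,
      InnerProductSpace.toDual_symm_apply]
    change starRingEnd ℂ (starRingEnd ℂ (Φ (J v))) = _
    simp)

/-- The real Hilbert space underlying a complex one as its own real dual: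
`hilbertRealDual H ζ v = Re ⟪ζ, v⟫`. -/
def hilbertRealDual : H ≃ₗᵢ[ℝ] StrongDual ℝ H :=
  LinearIsometryEquiv.trans
    { toFun := fun v => InnerProductSpace.toDual ℂ H v
      invFun := fun ℓ => (InnerProductSpace.toDual ℂ H).symm ℓ
      left_inv := fun v => by simp
      right_inv := fun ℓ => by simp
      map_add' := fun v w => by simp
      map_smul' := fun r v => by
        change InnerProductSpace.toDual ℂ H ((r : ℂ) • v) = (r : ℂ) • InnerProductSpace.toDual ℂ H v
        rw [map_smulₛₗ, Complex.conj_ofReal]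
      norm_map' := fun v => (InnerProductSpace.toDual ℂ H).norm_map v }
    (StrongDual.extendRCLikeₗᵢ (𝕜 := ℂ) (F := H)).symm

variable {H} {M X : Type*} [NormedAddCommGroup M] [NormedSpace ℂ M]
  [NormedAddCommGroup X] [NormedSpace ℂ X]

/-- The real duality underlying a complex one: `realDual e x b = Re (e x b)`. -/
def realDual (e : M ≃ₗᵢ[ℂ] StrongDual ℂ X) : M ≃ₗᵢ[ℝ] StrongDual ℝ X :=
  LinearIsometryEquiv.trans
    { __ := e.toLinearEquiv.restrictScalars ℝ
      norm_map' := fun x => e.norm_map x }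
    (StrongDual.extendRCLikeₗᵢ (𝕜 := ℂ) (F := X)).symm

theorem hilbertBidual_apply (ζ : H) (ℓ : StrongDual ℂ H) : hilbertBidual H ζ ℓ = ℓ ζ := rfl

theorem hilbertRealDual_apply (ζ v : H) : hilbertRealDual H ζ v = (inner ℂ ζ v).re := rfl

theorem realDual_apply (e : M ≃ₗᵢ[ℂ] StrongDual ℂ X) (x : M) (b : X) :
    realDual e x b = (e x b).re := rfl

end Pairings

/-! ## Trace class operators and the trace -/

section TraceClass

open InnerProductSpace

variable {H : Type*} [NormedAddCommGroup H] [InnerProductSpace ℂ H]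

/-- `T = ∑ₙ |xₙ⟩⟨yₙ|` with `∑ₙ ‖xₙ‖ ‖yₙ‖ < ∞`. -/
structure IsNuclearExpansion (T : H →L[ℂ] H) (x y : ℕ → H) : Prop where
  summable : Summable fun k => ‖x k‖ * ‖y k‖
  hasSum : HasSum (fun k => rankOne ℂ (x k) (y k)) T

theorem IsNuclearExpansion.zero : IsNuclearExpansion (0 : H →L[ℂ] H) 0 0 :=
  ⟨by simp, by simp⟩

theorem IsNuclearExpansion.smul {T : H →L[ℂ] H} {x y : ℕ → H} (hT : IsNuclearExpansion T x y)
    (r : ℂ) : IsNuclearExpansion (r • T) (fun k => r • x k) y := by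
  refine ⟨?_, ?_⟩
  · simpa [norm_smul, mul_assoc] using hT.summable.mul_left ‖r‖
  · simpa using hT.hasSum.const_smul r

theorem IsNuclearExpansion.add {S T : H →L[ℂ] H} {x y x' y' : ℕ → H}
    (hS : IsNuclearExpansion S x y) (hT : IsNuclearExpansion T x' y') :
    ∃ u v : ℕ → H, IsNuclearExpansion (S + T) u v ∧
      ∑' k, ‖u k‖ * ‖v k‖ = ∑' k, ‖x k‖ * ‖y k‖ + ∑' k, ‖x' k‖ * ‖y' k‖ := by
  let e := Equiv.natSumNatEquivNat
  have key : HasSum (fun k => ‖Sum.elim x x' (e.symm k)‖ * ‖Sum.elim y y' (e.symm k)‖)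
      (∑' k, ‖x k‖ * ‖y k‖ + ∑' k, ‖x' k‖ * ‖y' k‖) := by
    refine (e.symm.hasSum_iff (f := fun s : ℕ ⊕ ℕ => ‖Sum.elim x x' s‖ * ‖Sum.elim y y' s‖)).mpr ?_
    exact HasSum.sum hS.summable.hasSum hT.summable.hasSum
  refine ⟨fun k => Sum.elim x x' (e.symm k), fun k => Sum.elim y y' (e.symm k), ⟨key.summable, ?_⟩,
    key.tsum_eq⟩
  refine (e.symm.hasSum_iff
    (f := fun s : ℕ ⊕ ℕ => rankOne ℂ (Sum.elim x x' s) (Sum.elim y y' s))).mpr ?_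
  exact HasSum.sum hS.hasSum hT.hasSum

theorem IsNuclearExpansion.norm_le {T : H →L[ℂ] H} {x y : ℕ → H}
    (hT : IsNuclearExpansion T x y) : ‖T‖ ≤ ∑' k, ‖x k‖ * ‖y k‖ := by
  rw [← hT.hasSum.tsum_eq]
  refine (norm_tsum_le_tsum_norm (by simpa using hT.summable)).trans_eq ?_
  simp

variable (H) in
/-- The subspace of trace class (= nuclear) operators. -/
def traceClassSubmodule : Submodule ℂ (H →L[ℂ] H) where
  carrier := {T | ∃ x y, IsNuclearExpansion T x y}
  zero_mem' := ⟨0, 0, .zero⟩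
  add_mem' := by
    rintro S T ⟨x, y, hS⟩ ⟨x', y', hT⟩
    obtain ⟨u, v, h, -⟩ := hS.add hT
    exact ⟨u, v, h⟩
  smul_mem' := by
    rintro r T ⟨x, y, hT⟩
    exact ⟨_, _, hT.smul r⟩

variable (H) in
/-- The space `L¹(H)` of trace class operators; it carries the trace norm. -/
def TraceClass : Type _ := traceClassSubmodule H

namespace TraceClass

instance : AddCommGroup (TraceClass H) := inferInstanceAs (AddCommGroup (traceClassSubmodule H))

instance : Module ℂ (TraceClass H) := inferInstanceAs (Module ℂ (traceClassSubmodule H))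

/-- The bounded operator underlying a trace class operator. -/
def toCLM (T : TraceClass H) : H →L[ℂ] H := Subtype.val T

/-- The trace norm, i.e. the infimum of `∑ ‖xₙ‖ ‖yₙ‖` over all expansions
`T = ∑ |xₙ⟩⟨yₙ|`. -/
instance : Norm (TraceClass H) where
  norm T := sInf {r : ℝ | ∃ x y, IsNuclearExpansion T.toCLM x y ∧ r = ∑' k, ‖x k‖ * ‖y k‖}

theorem norm_le {T : TraceClass H} {x y : ℕ → H} (hT : IsNuclearExpansion T.toCLM x y) :
    ‖T‖ ≤ ∑' k, ‖x k‖ * ‖y k‖ := by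
  refine csInf_le ⟨0, ?_⟩ ⟨x, y, hT, rfl⟩
  rintro r ⟨x, y, -, rfl⟩
  positivity

theorem le_norm {T : TraceClass H} {r : ℝ}
    (hr : ∀ x y, IsNuclearExpansion T.toCLM x y → r ≤ ∑' k, ‖x k‖ * ‖y k‖) : r ≤ ‖T‖ := by
  refine le_csInf ?_ ?_
  · obtain ⟨x, y, h⟩ := T.2
    exact ⟨_, x, y, h, rfl⟩
  · rintro _ ⟨x, y, h, rfl⟩
    exact hr x y h

theorem norm_toCLM_le (T : TraceClass H) : ‖T.toCLM‖ ≤ ‖T‖ :=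
  le_norm fun _ _ h => h.norm_le

theorem norm_smul_le' (r : ℂ) (T : TraceClass H) : ‖r • T‖ ≤ ‖r‖ * ‖T‖ := by
  rcases eq_or_ne r 0 with rfl | hr
  · have h0 : IsNuclearExpansion ((0 : ℂ) • T : TraceClass H).toCLM 0 0 := by
      rw [zero_smul]; exact .zero
    simpa using norm_le h0
  · have hr' : 0 < ‖r‖ := norm_pos_iff.mpr hr
    rw [← div_le_iff₀' hr']
    refine le_norm fun x y h => ?_
    rw [div_le_iff₀' hr']
    refine (norm_le (T := r • T) (h.smul r)).trans_eq ?_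
    rw [← tsum_mul_left]
    exact tsum_congr fun k => by rw [norm_smul, mul_assoc]

theorem normedSpaceCore : NormedSpace.Core ℂ (TraceClass H) where
  norm_nonneg T := le_norm fun x y _ => tsum_nonneg fun k => by positivity
  norm_smul r T := by
    refine le_antisymm (norm_smul_le' r T) ?_
    rcases eq_or_ne r 0 with rfl | hr
    · rw [norm_zero, zero_mul]
      exact le_norm fun x y _ => tsum_nonneg fun k => by positivity
    · have h := norm_smul_le' r⁻¹ (r • T)
      rw [smul_smul, inv_mul_cancel₀ hr, one_smul, norm_inv] at h
      rwa [← le_inv_mul_iff₀ (norm_pos_iff.mpr hr)]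
  norm_triangle S T := by
    rw [← sub_le_iff_le_add']
    refine le_norm fun x' y' hT => ?_
    rw [sub_le_comm]
    refine le_norm fun x y hS => ?_
    obtain ⟨u, v, h, huv⟩ := hS.add hT
    rw [sub_le_iff_le_add, ← huv]
    exact norm_le (T := S + T) h
  norm_eq_zero_iff T := by
    constructor
    · intro h
      have h1 : ‖T.toCLM‖ ≤ 0 := h ▸ norm_toCLM_le T
      exact Subtype.ext (norm_le_zero_iff.mp h1)
    · rintro rfl
      refine le_antisymm ?_ (le_norm fun x y _ => tsum_nonneg fun k => by positivity)
      simpa using norm_le (T := (0 : TraceClass H)) .zero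

instance : NormedAddCommGroup (TraceClass H) := NormedAddCommGroup.ofCore normedSpaceCore

instance : NormedSpace ℂ (TraceClass H) := NormedSpace.ofCore normedSpaceCore

end TraceClass

variable [CompleteSpace H]

/-- The trace `∑ᵢ ⟨eᵢ | T eᵢ⟩` of an operator, computed in some Hilbert basis. -/
def opTrace (T : H →L[ℂ] H) : ℂ :=
  ∑' i : (exists_hilbertBasis ℂ H).choose, inner ℂ (i : H) (T i)

/-- The weak topology `σ(M, X)` on `M` given by a pairing of `M` with `X`. -/
@[reducible]
def sigmaTopology {M X : Type*} (p : M → X → ℂ) : TopologicalSpace M :=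
  TopologicalSpace.induced p inferInstance

/-- The `*`-representation `φ` of the W*-algebra `M` with predual `X` is a W*-representation:
it is continuous from `σ(M, X)` to the ultraweak topology `σ(L^∞(H), L¹(H))`. -/
def IsWStarRepresentation {M X : Type*} [CStarAlgebra M] [NormedAddCommGroup X] [NormedSpace ℂ X]
    (e : M ≃ₗᵢ[ℂ] StrongDual ℂ X) (φ : M →⋆ₙₐ[ℂ] (H →L[ℂ] H)) : Prop :=
  @Continuous M (H →L[ℂ] H) (sigmaTopology fun x b => e x b)
    (sigmaTopology fun A (ρ : TraceClass H) => opTrace (ρ.toCLM ∘L A)) φ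

end TraceClass

end

open scoped ContDiff Topology

noncomputable section

/-! ## Separate weak-* continuity of the multiplication of a W*-algebra -/

section Bidual

variable {E : Type*} [NormedAddCommGroup E] [NormedSpace ℂ E]

/-! The analytic core is that left and right multiplications of a W*-algebra `M` with predual `X`
are weak-* continuous, so that the coadjoint action preserves `X`. Restricting functionals on `M*`
to `X` gives a contractive projection `P : M** → M`. If `P` commutes with the second adjoint `S**`,
then `S` is weak-* continuous: a `ξ` in `M**` vanishing on `X` has `P ξ = 0`, hence `P (S** ξ) = 0`,
so `ξ` also annihilates `b ∘ S` for `b` in `X`, and Hahn-Banach puts `b ∘ S` in `X`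
(`exists_predual_of_proj_bidualMap`).

For multiplication by a positive contraction, commutation with `P` comes from the continuous
functional calculus. By the C*-identity, pieces cut out by functions with vanishing products satisfy
a Pythagorean inequality. It passes to the bidual, and an argument of Tomiyama's type then shows
that `P` respects such pieces (`apply_proj_bidualMap_eq_zero`). Slicing into `n` layers bounds `n`
times the commutator by a multiple of `√n` (`proj_bidualMap`), so the commutator vanishes. Positive
contractions span `M`.

On the Poisson side, `{f, g}(z) = ⟨[Df(z), Dg(z)], z⟩`. Once the coadjoint action preserves the
predual, Hamiltonian vector fields exist, and Jacobi reduces to that of the dual Lie algebra because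
the second-derivative terms cancel by symmetry. The bracket formula leaves no freedom, whence
uniqueness.

Trace class operators are handled through nuclear expansions. Parseval and Fubini make the trace
independent of the basis, and bounded sesquilinear forms identify the dual. A matrix coefficient is
a trace pairing with a rank one operator, so a W*-representation has its coefficients in `X`; this
is the second semidirect condition. Hamilton's equation is tested on linear functionals, and its
trace class component on rank one operators. -/

/-- The second adjoint of a bounded operator. -/
def bidualMap (S : E →L[ℂ] E) :
    StrongDual ℂ (StrongDual ℂ E) →L[ℂ] StrongDual ℂ (StrongDual ℂ E) :=
  (ContinuousLinearMap.compL ℂ _ _ ℂ).flip ((ContinuousLinearMap.compL ℂ E E ℂ).flip S)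

@[simp]
theorem bidualMap_apply (S : E →L[ℂ] E) (ξ : StrongDual ℂ (StrongDual ℂ E))
    (ℓ : StrongDual ℂ E) : bidualMap S ξ ℓ = ξ (ℓ ∘L S) := rfl

theorem norm_bidualMap_apply_le (S : E →L[ℂ] E) (ξ : StrongDual ℂ (StrongDual ℂ E)) :
    ‖bidualMap S ξ‖ ≤ ‖S‖ * ‖ξ‖ := by
  refine ContinuousLinearMap.opNorm_le_bound _ (by positivity) fun ℓ => ?_
  rw [bidualMap_apply]
  calc ‖ξ (ℓ ∘L S)‖ ≤ ‖ξ‖ * ‖ℓ ∘L S‖ := ξ.le_opNorm _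
    _ ≤ ‖ξ‖ * (‖ℓ‖ * ‖S‖) := by gcongr; exact ℓ.opNorm_comp_le S
    _ = ‖S‖ * ‖ξ‖ * ‖ℓ‖ := by ring

/-- A unimodular number rotating `z` to the nonnegative real axis. -/
theorem exists_unimodular_mul_eq_norm (z : ℂ) : ∃ θ : ℂ, ‖θ‖ = 1 ∧ θ * z = ‖z‖ := by
  rcases eq_or_ne z 0 with rfl | hz
  · exact ⟨1, by simp, by simp⟩
  · have h0 : (‖z‖ : ℂ) ≠ 0 := by simpa using hz
    refine ⟨(starRingEnd ℂ) z / ‖z‖, ?_, ?_⟩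
    · rw [norm_div, RCLike.norm_conj, Complex.norm_real, norm_norm, div_self]
      simpa using hz
    · rw [div_mul_eq_mul_div, mul_comm, Complex.mul_conj, Complex.normSq_eq_norm_sq]
      field_simp
      push_cast
      ring

/-- Only `‖ξ‖` enters the estimate: for a functional `ℓ`, the hypothesis at vectors of norm `‖ξ‖`
bounds `‖ξ‖ * ‖ℓ ∘L S‖ + ‖ℓ m‖`, which dominates the value of the left-hand functional at `ℓ`. -/
theorem norm_bidualMap_add_sq_le {S : E →L[ℂ] E} {m : E}
    (hS : ∀ x, ‖S x + m‖ ^ 2 ≤ ‖x‖ ^ 2 + ‖m‖ ^ 2) (ξ : StrongDual ℂ (StrongDual ℂ E)) :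
    ‖bidualMap S ξ + NormedSpace.inclusionInDoubleDual ℂ E m‖ ^ 2 ≤ ‖ξ‖ ^ 2 + ‖m‖ ^ 2 := by
  set R := Real.sqrt (‖ξ‖ ^ 2 + ‖m‖ ^ 2) with hR
  have hR0 : 0 ≤ R := Real.sqrt_nonneg _
  suffices h : ‖bidualMap S ξ + NormedSpace.inclusionInDoubleDual ℂ E m‖ ≤ R by
    calc _ ≤ R ^ 2 := by gcongr
      _ = _ := Real.sq_sqrt (by positivity)
  refine ContinuousLinearMap.opNorm_le_bound _ hR0 fun ℓ => ?_
  rw [add_apply, bidualMap_apply, NormedSpace.dual_def]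
  have key : ‖ξ‖ * ‖ℓ ∘L S‖ + ‖ℓ m‖ ≤ R * ‖ℓ‖ := by
    rw [← le_sub_iff_add_le]
    rcases (norm_nonneg ξ).eq_or_lt with h0 | h0
    · have : R = ‖m‖ := by rw [hR, ← h0]; simp
      rw [← h0, zero_mul, this, sub_nonneg, mul_comm]
      exact ℓ.le_opNorm m
    have hm : ‖ℓ m‖ ≤ R * ‖ℓ‖ := by
      refine (ℓ.le_opNorm m).trans ?_
      rw [mul_comm]
      gcongr
      exact Real.le_sqrt_of_sq_le (by nlinarith)
    rw [← le_div_iff₀' h0]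
    refine ContinuousLinearMap.opNorm_le_of_unit_norm (by
      exact div_nonneg (by linarith) h0.le) fun x hx => ?_
    rw [le_div_iff₀' h0, le_sub_iff_add_le]
    -- The two phases align `ℓ (S x)` with `ℓ m`, so that both moduli are collected in a single
    -- value of `ℓ`, at a multiple of `x` of norm `‖ξ‖`.
    obtain ⟨θ, hθ, h1⟩ := exists_unimodular_mul_eq_norm (ℓ (S x))
    obtain ⟨τ, hτ, h2⟩ := exists_unimodular_mul_eq_norm (ℓ m)
    have hτ0 : τ ≠ 0 := by rintro rfl; simp at hτ
    have h3 : τ * ℓ (S ((τ⁻¹ * θ * ‖ξ‖ : ℂ) • x) + m) = (‖ξ‖ * ‖ℓ (S x)‖ + ‖ℓ m‖ : ℝ) := by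
      rw [map_add, map_smul, map_smul, mul_add, h2, smul_eq_mul]
      push_cast
      rw [← h1]
      field_simp
    have h4 : ‖(τ⁻¹ * θ * ‖ξ‖ : ℂ) • x‖ = ‖ξ‖ := by
      rw [norm_smul, norm_mul, norm_mul, norm_inv, hθ, hτ, hx]; simp [h0.le]
    have h5 := congrArg norm h3
    rw [norm_mul, hτ, one_mul, Complex.norm_real, Real.norm_of_nonneg (by positivity)] at h5
    change ‖ξ‖ * ‖ℓ (S x)‖ + ‖ℓ m‖ ≤ _
    rw [← h5, mul_comm R]
    refine (ℓ.le_opNorm _).trans ?_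
    gcongr
    refine Real.le_sqrt_of_sq_le ?_
    have := hS ((τ⁻¹ * θ * ‖ξ‖ : ℂ) • x)
    rwa [h4] at this
  calc _ ≤ ‖ξ (ℓ ∘L S)‖ + ‖ℓ m‖ := norm_add_le _ _
    _ ≤ ‖ξ‖ * ‖ℓ ∘L S‖ + ‖ℓ m‖ := by gcongr; exact ξ.le_opNorm _
    _ ≤ _ := key

end Bidual

/-! ### Contractive projections of the bidual commute with an orthogonal functional calculus -/

section FunctionalCalculus

/-- This cuts the interval from 0 to `s` into layers of height one; it is used to write `n • u` as a
sum of functions with values in `[0, 1]`. -/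
theorem sum_clamp {s : ℝ} (hs : 0 ≤ s) (n : ℕ) :
    ∑ i ∈ Finset.range n, max 0 (min 1 (s - i)) = min s n := by
  induction n with
  | zero => simp [hs]
  | succ n ih =>
    rw [Finset.sum_range_succ, ih]
    push_cast
    rcases le_total s n with h | h
    · rw [min_eq_left h, min_eq_right (a := 1) (by linarith), max_eq_left (by linarith), add_zero,
        min_eq_left (by linarith)]
    · rw [min_eq_right h]
      rcases le_total s (n + 1) with h' | h'
      · rw [min_eq_left h', min_eq_right (a := 1) (by linarith), max_eq_right (by linarith)]; ring
      · rw [min_eq_right h', min_eq_left (a := 1) (by linarith), max_eq_right (by linarith)]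

variable {E : Type*} [NormedAddCommGroup E] [NormedSpace ℂ E] {K : Type*} [TopologicalSpace K]
  [CompactSpace K]

/-- A contractive action of `C(K, ℝ)` on a Banach space such that functions with pairwise vanishing
products produce vectors which satisfy the parallelogram inequality of orthogonal vectors. -/
structure IsOrthogonalCalculus (T : C(K, ℝ) →ₗ[ℝ] (E →L[ℂ] E)) : Prop where
  map_one : T 1 = 1
  map_mul : ∀ f g, T (f * g) = T f * T g
  norm_le : ∀ f, ‖T f‖ ≤ ‖f‖
  norm_sum_sq_le : ∀ (s : Finset ℕ) (f : ℕ → C(K, ℝ)) (x : ℕ → E),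
    (∀ i ∈ s, ∀ j ∈ s, i ≠ j → f i * f j = 0) →
    ‖∑ i ∈ s, T (f i) (x i)‖ ^ 2 ≤ ∑ i ∈ s, ‖T (f i) (x i)‖ ^ 2

namespace IsOrthogonalCalculus

variable {T : C(K, ℝ) →ₗ[ℝ] (E →L[ℂ] E)} (hT : IsOrthogonalCalculus T)
include hT

theorem norm_add_sq_le {f g : C(K, ℝ)} (hfg : f * g = 0) (x y : E) :
    ‖T f x + T g y‖ ^ 2 ≤ ‖T f x‖ ^ 2 + ‖T g y‖ ^ 2 := by
  have := hT.norm_sum_sq_le {0, 1} (fun i => if i = 0 then f else g)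
    (fun i => if i = 0 then x else y) (by simp [hfg, mul_comm g f])
  simpa using this

theorem norm_apply_le {f : C(K, ℝ)} (hf : ‖f‖ ≤ 1) (x : E) : ‖T f x‖ ≤ ‖x‖ :=
  ((T f).le_of_opNorm_le ((hT.norm_le f).trans hf) x).trans_eq (one_mul _)

variable {P : StrongDual ℂ (StrongDual ℂ E) →L[ℂ] E} (hP : ∀ ξ, ‖P ξ‖ ≤ ‖ξ‖)
  (hPi : ∀ x, P (NormedSpace.inclusionInDoubleDual ℂ E x) = x)
include hP hPi

/-- Tomiyama's trick: let `m` be the vector claimed to vanish and perturb by `t • m`. A contraction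
sends the perturbed vector to `(1 + t) • m`, whereas the Pythagorean inequality bounds its squared
norm by `‖ξ‖ ^ 2 + t ^ 2 * ‖m‖ ^ 2`. The quadratic terms cancel and a bound linear in `t` remains,
which is absurd for large `t` unless `m = 0`. -/
theorem apply_proj_bidualMap_eq_zero {f g : C(K, ℝ)} (hf : ‖f‖ ≤ 1) (hg0 : ∀ k, 0 ≤ g k)
    (hg1 : ∀ k, g k ≤ 1) (hfg : f * g = 0) (ξ : StrongDual ℂ (StrongDual ℂ E)) :
    T g (P (bidualMap (T f) ξ)) = 0 := by
  set w := P (bidualMap (T f) ξ) with hw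
  set m := T g w with hm
  have key : ∀ t : ℝ, 0 ≤ t → (1 + 2 * t) * ‖m‖ ^ 2 ≤ ‖ξ‖ ^ 2 := by
    intro t ht
    have hpos : ∀ k, 0 < 1 + t * g k := fun k => by have := mul_nonneg ht (hg0 k); linarith
    -- `T (1 + t • g)` maps `w` to `w + t • m`. Dividing by `1 + t * g` makes `T b` turn this into
    -- `(1 + t) • m`, and `g ≤ 1` keeps `b ≤ 1`.
    let b : C(K, ℝ) := ⟨fun k => (1 + t) * g k / (1 + t * g k), by
      refine Continuous.div (by fun_prop) (by fun_prop) fun k => (hpos k).ne'⟩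
    have hb : ‖b‖ ≤ 1 := by
      refine (ContinuousMap.norm_le _ zero_le_one).mpr fun k => ?_
      have h1 : 0 ≤ b k := div_nonneg (mul_nonneg (by linarith) (hg0 k)) (hpos k).le
      rw [Real.norm_of_nonneg h1]
      exact (div_le_one (hpos k)).mpr (by linarith [hg1 k])
    have hb2 : b * (1 + t • g) = (1 + t) • g := by
      ext k
      change (1 + t) * g k / (1 + t * g k) * (1 + t * g k) = (1 + t) * g k
      exact div_mul_cancel₀ _ (hpos k).ne'
    have h1 : T b (w + (t : ℂ) • m) = ((1 + t : ℝ) : ℂ) • m := by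
      have := congrArg (fun S => T S w) hb2
      simp only [hT.map_mul, map_add, map_smul, hT.map_one] at this
      simpa [add_smul] using this
    have h2 : w + (t : ℂ) • m =
        P (bidualMap (T f) ξ + NormedSpace.inclusionInDoubleDual ℂ E ((t : ℂ) • m)) := by
      rw [map_add, hPi]
    have h3 : ∀ x, ‖T f x + (t : ℂ) • m‖ ^ 2 ≤ ‖x‖ ^ 2 + ‖(t : ℂ) • m‖ ^ 2 := by
      intro x
      have := hT.norm_add_sq_le hfg x ((t : ℂ) • w)
      rw [map_smul] at this
      refine this.trans ?_
      gcongr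
      exact hT.norm_apply_le hf x
    have h4 : ((1 + t) * ‖m‖) ^ 2 ≤ ‖ξ‖ ^ 2 + ‖(t : ℂ) • m‖ ^ 2 := by
      calc ((1 + t) * ‖m‖) ^ 2 = ‖T b (w + (t : ℂ) • m)‖ ^ 2 := by
            rw [h1, norm_smul, Complex.norm_real, Real.norm_of_nonneg (by linarith)]
        _ ≤ ‖w + (t : ℂ) • m‖ ^ 2 := by gcongr; exact hT.norm_apply_le hb _
        _ ≤ _ := by
          rw [h2]
          refine le_trans ?_ (norm_bidualMap_add_sq_le h3 ξ)
          gcongr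
          exact hP _
    rw [norm_smul, Complex.norm_real, Real.norm_of_nonneg ht] at h4
    nlinarith
  by_contra hne
  have hpos : 0 < ‖m‖ ^ 2 := by have := norm_pos_iff.mpr hne; positivity
  -- At this `t` the left side of `key` equals `‖m‖ ^ 2 + 2 * ‖ξ‖ ^ 2`, which exceeds `‖ξ‖ ^ 2`.
  have := key (‖ξ‖ ^ 2 / ‖m‖ ^ 2) (by positivity)
  have h5 : ‖ξ‖ ^ 2 / ‖m‖ ^ 2 * ‖m‖ ^ 2 = ‖ξ‖ ^ 2 := div_mul_cancel₀ _ hpos.ne'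
  nlinarith [sq_nonneg ‖ξ‖]

-- Only neighbouring indices interact, so the even and the odd terms are two orthogonal families.
-- Each contributes at most `√n * C`, where the triangle inequality would only give order `n`.
omit hP hPi in
theorem norm_sum_apply_le {h : ℕ → C(K, ℝ)} (hh : ∀ i, ‖h i‖ ≤ 1)
    (horth : ∀ i j, i + 2 ≤ j → h i * h j = 0) {C : ℝ} {x : ℕ → E} (hx : ∀ i, ‖x i‖ ≤ C)
    (n : ℕ) : ‖∑ i ∈ Finset.range n, T (h i) (x i)‖ ≤ 2 * (Real.sqrt n * C) := by
  have hC : 0 ≤ C := (norm_nonneg _).trans (hx 0)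
  have key : ∀ s ⊆ Finset.range n, (∀ i ∈ s, ∀ j ∈ s, i < j → i + 2 ≤ j) →
      ‖∑ i ∈ s, T (h i) (x i)‖ ≤ Real.sqrt n * C := by
    intro s hs hs2
    refine le_of_sq_le_sq ?_ (by positivity)
    rw [mul_pow, Real.sq_sqrt (by positivity)]
    refine (hT.norm_sum_sq_le s h x fun i hi j hj hij => ?_).trans ?_
    · rcases hij.lt_or_gt with hlt | hlt
      · exact horth i j (hs2 i hi j hj hlt)
      · rw [mul_comm]; exact horth j i (hs2 j hj i hi hlt)
    · calc ∑ i ∈ s, ‖T (h i) (x i)‖ ^ 2 ≤ ∑ i ∈ s, C ^ 2 := by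
            gcongr with i hi
            exact (hT.norm_apply_le (hh i) _).trans (hx i)
        _ ≤ ∑ i ∈ Finset.range n, C ^ 2 :=
            Finset.sum_le_sum_of_subset_of_nonneg hs fun _ _ _ => by positivity
        _ = n * C ^ 2 := by simp
  rw [← Finset.sum_filter_add_sum_filter_not (Finset.range n) Even, two_mul]
  refine (norm_add_le _ _).trans (add_le_add (key _ (Finset.filter_subset _ _) ?_)
    (key _ (Finset.filter_subset _ _) ?_))
  all_goals
    intro i hi j hj hij
    simp only [Finset.mem_filter, Nat.even_iff] at hi hj
    omega

/-- Cut `n • u` into `n` layers. The commutator error of each layer lives on the transitions to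
adjacent layers, and nonadjacent transitions are orthogonal. Hence `n` times the commutator is
`O(√n)`. -/
theorem proj_bidualMap {u : C(K, ℝ)} (hu0 : ∀ k, 0 ≤ u k) (hu1 : ∀ k, u k ≤ 1)
    (ξ : StrongDual ℂ (StrongDual ℂ E)) : P (bidualMap (T u) ξ) = T u (P ξ) := by
  have key : ∀ n : ℕ, ‖(n : ℝ) • (P (bidualMap (T u) ξ) - T u (P ξ))‖
      ≤ 4 * (Real.sqrt n * ‖ξ‖) := by
    intro n
    -- Indices are integers because layer 0 is compared with its lower neighbour `r (-1)`.
    let r : ℤ → C(K, ℝ) := fun i => ⟨fun k => max 0 (min 1 (n * u k - i)), by fun_prop⟩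
    have hr : ∀ i k, r i k = max 0 (min 1 (n * u k - i)) := fun _ _ => rfl
    have hr0 : ∀ i k, 0 ≤ r i k := fun i k => le_max_left _ _
    have hr1 : ∀ i k, r i k ≤ 1 := fun i k => max_le zero_le_one (min_le_left _ _)
    have nrm : ∀ f : C(K, ℝ), (∀ k, 0 ≤ f k) → (∀ k, f k ≤ 1) → ‖f‖ ≤ 1 := fun f h0 h1 =>
      (ContinuousMap.norm_le _ zero_le_one).mpr fun k => by
        rw [Real.norm_of_nonneg (h0 k)]; exact h1 k
    have hc0 : ∀ i k, 0 ≤ (1 - r i) k := fun i k => sub_nonneg.mpr (hr1 i k)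
    have hc1 : ∀ i k, (1 - r i) k ≤ 1 := fun i k => sub_le_self _ (hr0 i k)
    have horth : ∀ i j : ℤ, i < j → r j * (1 - r i) = 0 := by
      intro i j hij
      ext k
      change r j k * (1 - r i k) = 0
      have hij' : (i : ℝ) + 1 ≤ j := by exact_mod_cast hij
      rcases le_total (n * u k) j with h | h
      · rw [hr j, min_eq_right (by linarith), max_eq_left (by linarith), zero_mul]
      · rw [hr i, min_eq_left (by linarith), max_eq_right zero_le_one, sub_self, mul_zero]
    -- The transition function between layers `i` and `i + 1`. By the vanishing lemma, `1 - r i`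
    -- acts on `y i` through `h (i - 1)`, and `r i` acts on `z i` through `h i`.
    let h : ℤ → C(K, ℝ) := fun i => r i * (1 - r (i + 1))
    have hh : ∀ i, ‖h i‖ ≤ 1 := fun i => nrm _ (fun k => mul_nonneg (hr0 i k) (hc0 _ k))
      fun k => mul_le_one₀ (hr1 i k) (hc0 _ k) (hc1 _ k)
    have hhorth : ∀ i j, i + 2 ≤ j → h i * h j = 0 := by
      intro i j hij
      have h0 := horth (i + 1) j (by omega)
      calc h i * h j = r i * (1 - r (j + 1)) * (r j * (1 - r (i + 1))) := by
            simp only [h]; ring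
        _ = 0 := by rw [h0, mul_zero]
    let y : ℤ → E := fun i => P (bidualMap (T (r i)) ξ)
    let z : ℤ → E := fun i => P (bidualMap (T (1 - r i)) ξ)
    have hbd : ∀ f : C(K, ℝ), ‖f‖ ≤ 1 → ‖P (bidualMap (T f) ξ)‖ ≤ ‖ξ‖ := fun f hf => by
      refine (hP _).trans ((norm_bidualMap_apply_le _ _).trans ?_)
      exact mul_le_of_le_one_left (norm_nonneg ξ) ((hT.norm_le f).trans hf)
    have hyz : ∀ i, y i + z i = P ξ := by
      intro i
      simp only [y, z]
      rw [← map_add]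
      congr 1
      ext ℓ
      rw [add_apply, bidualMap_apply, bidualMap_apply, ← map_add, ← ContinuousLinearMap.comp_add,
        ← map_add, add_sub_cancel, hT.map_one]
      rfl
    have hy : ∀ i, T (1 - r i) (y i) = T (h (i - 1)) (y i) := by
      intro i
      have h0 : T (1 - r (i - 1)) (y i) = 0 :=
        hT.apply_proj_bidualMap_eq_zero hP hPi (nrm _ (hr0 i) (hr1 i)) (hc0 _) (hc1 _)
          (horth _ _ (by omega)) ξ
      have h1 : (1 - r i) = h (i - 1) + (1 - r i) * (1 - r (i - 1)) := by
        simp only [h, sub_add_cancel]; ring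
      calc T (1 - r i) (y i) = T (h (i - 1) + (1 - r i) * (1 - r (i - 1))) (y i) := by rw [← h1]
        _ = T (h (i - 1)) (y i) + T (1 - r i) (T (1 - r (i - 1)) (y i)) := by
          rw [map_add, hT.map_mul (1 - r i)]; rfl
        _ = _ := by rw [h0, map_zero, add_zero]
    have hz : ∀ i, T (r i) (z i) = T (h i) (z i) := by
      intro i
      have h0 : T (r (i + 1)) (z i) = 0 :=
        hT.apply_proj_bidualMap_eq_zero hP hPi (nrm _ (hc0 i) (hc1 i)) (hr0 _) (hr1 _)
          (by rw [mul_comm]; exact horth _ _ (by omega)) ξ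
      have h1 : r i = h i + r i * r (i + 1) := by simp only [h]; ring
      calc T (r i) (z i) = T (h i + r i * r (i + 1)) (z i) := by rw [← h1]
        _ = T (h i) (z i) + T (r i) (T (r (i + 1)) (z i)) := by
          rw [map_add, hT.map_mul (r i) (r (i + 1))]; rfl
        _ = _ := by rw [h0, map_zero, add_zero]
    have hD : ∀ i, y i - T (r i) (P ξ) = T (h (i - 1)) (y i) - T (h i) (z i) := by
      intro i
      rw [← hy, ← hz, ← hyz i, map_add, map_sub, hT.map_one]
      simp only [sub_apply, one_apply_eq_self]
      abel
    have hsum : ∑ i ∈ Finset.range n, r i = (n : ℝ) • u := by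
      ext k
      rw [ContinuousMap.sum_apply]
      simp only [hr, Int.cast_natCast]
      rw [sum_clamp (mul_nonneg (Nat.cast_nonneg n) (hu0 k)), min_eq_left]
      · rfl
      · exact mul_le_of_le_one_right (by positivity) (hu1 k)
    have hS1 : ∑ i ∈ Finset.range n, T (r i) (P ξ) = (n : ℝ) • T u (P ξ) := by
      have := congrArg (fun f => T f (P ξ)) hsum
      simpa [map_sum, _root_.sum_apply] using this
    have hS2 : ∑ i ∈ Finset.range n, y i = (n : ℝ) • P (bidualMap (T u) ξ) := by
      have hl : ∀ ℓ, ∑ i ∈ Finset.range n, bidualMap (T (r i)) ξ ℓ =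
          (n : ℝ) • bidualMap (T u) ξ ℓ := by
        intro ℓ
        simp only [bidualMap_apply]
        rw [← map_sum]
        have : ∑ i ∈ Finset.range n, ℓ ∘L T (r i) = (n : ℂ) • (ℓ ∘L T u) := by
          ext x
          have := congrArg (fun f => ℓ (T f x)) hsum
          simpa [map_sum, _root_.sum_apply] using this
        rw [this, map_smul]
        simp
      have hl' : ∑ i ∈ Finset.range n, bidualMap (T (r i)) ξ = (n : ℂ) • bidualMap (T u) ξ := by
        ext ℓ
        rw [_root_.sum_apply, hl]
        simp
      simp only [y]
      rw [← map_sum, hl', map_smul, Nat.cast_smul_eq_nsmul ℂ, Nat.cast_smul_eq_nsmul ℝ]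
    rw [smul_sub, ← hS1, ← hS2, ← Finset.sum_sub_distrib]
    simp only [hD]
    rw [Finset.sum_sub_distrib]
    refine (norm_sub_le _ _).trans ?_
    have e1 := hT.norm_sum_apply_le (h := fun i : ℕ => h (i - 1)) (fun i => hh _)
      (fun i j hij => hhorth _ _ (by omega)) (C := ‖ξ‖) (x := fun i : ℕ => y i)
      (fun i => hbd _ (nrm _ (hr0 _) (hr1 _))) n
    have e2 := hT.norm_sum_apply_le (h := fun i : ℕ => h i) (fun i => hh _)
      (fun i j hij => hhorth _ _ (by omega)) (C := ‖ξ‖) (x := fun i : ℕ => z i)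
      (fun i => hbd _ (nrm _ (hc0 _) (hc1 _))) n
    linarith
  rw [← sub_eq_zero, ← norm_eq_zero]
  set d := ‖P (bidualMap (T u) ξ) - T u (P ξ)‖ with hd
  have hd0 : 0 ≤ d := norm_nonneg _
  by_contra hne
  have hpos : 0 < d := lt_of_le_of_ne hd0 (Ne.symm hne)
  -- Squaring `n * d ≤ 4 * √n * ‖ξ‖` gives `n * d ^ 2 ≤ 16 * ‖ξ‖ ^ 2`, which this `n` violates.
  obtain ⟨n, hn⟩ := exists_nat_gt (16 * ‖ξ‖ ^ 2 / d ^ 2)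
  have hn0 : (0 : ℝ) < n := lt_of_le_of_lt (by positivity) hn
  rw [div_lt_iff₀ (by positivity)] at hn
  have h1 := key n
  rw [norm_smul, Real.norm_of_nonneg hn0.le, ← hd] at h1
  have h2 : (n * d) ^ 2 ≤ (4 * (Real.sqrt n * ‖ξ‖)) ^ 2 := by gcongr
  have h3 : (4 * (Real.sqrt n * ‖ξ‖)) ^ 2 = n * (16 * ‖ξ‖ ^ 2) := by
    rw [mul_pow, mul_pow, Real.sq_sqrt hn0.le]; ring
  rw [h3, mul_pow, sq (n : ℝ), mul_assoc] at h2
  have := le_of_mul_le_mul_left h2 hn0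
  linarith

end IsOrthogonalCalculus

end FunctionalCalculus

/-! ### From commutation with projections to weak-* continuity -/

section WeakStar

theorem exists_dual_separating_submodule {F : Type*} [NormedAddCommGroup F] [NormedSpace ℂ F]
    (R : Submodule ℂ F) (hR : IsClosed (R : Set F)) {x : F} (hx : x ∉ R) :
    ∃ ξ : StrongDual ℂ F, (∀ r ∈ R, ξ r = 0) ∧ ξ x ≠ 0 := by
  have : IsClosed (R : Set F) := hR
  have hq : R.mkQ x ≠ 0 := by
    rwa [Ne, Submodule.mkQ_apply, Submodule.Quotient.mk_eq_zero]
  have hn : ‖R.mkQ x‖ ≠ 0 := by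
    intro h
    exact hq (norm_eq_zero.mp h)
  obtain ⟨g, -, hg⟩ := exists_dual_vector ℂ (R.mkQ x) hn
  refine ⟨g ∘L R.mkQL, fun r hr => ?_, ?_⟩
  · change g (R.mkQ r) = 0
    rw [(Submodule.Quotient.mk_eq_zero R).mpr hr |> fun h => (h : R.mkQ r = 0), map_zero]
  · change g (R.mkQ x) ≠ 0
    rw [hg]
    simpa using hn

/-- An operator on the dual of `X` which commutes with the contractive projections of the bidual
onto it is weak-* continuous. -/
theorem exists_predual_of_proj_bidualMap {M X : Type*} [NormedAddCommGroup M] [NormedSpace ℂ M]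
    [NormedAddCommGroup X] [NormedSpace ℂ X] [CompleteSpace X] (e : M ≃ₗᵢ[ℂ] StrongDual ℂ X)
    {S : M →L[ℂ] M}
    (hS : ∀ P : StrongDual ℂ (StrongDual ℂ M) →L[ℂ] M, (∀ ξ, ‖P ξ‖ ≤ ‖ξ‖) →
      (∀ x, P (NormedSpace.inclusionInDoubleDual ℂ M x) = x) →
      ∀ ξ, P (bidualMap S ξ) = S (P ξ)) (b : X) :
    ∃ b' : X, ∀ x, e (S x) b = e x b' := by
  let j : X →L[ℂ] StrongDual ℂ M :=
    ((ContinuousLinearMap.compL ℂ M (StrongDual ℂ X) ℂ).flip e.toContinuousLinearEquiv) ∘L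
      NormedSpace.inclusionInDoubleDual ℂ X
  have hj : ∀ b x, j b x = e x b := fun _ _ => rfl
  have hjn : ∀ b, ‖j b‖ = ‖b‖ := by
    intro b
    change ‖(NormedSpace.inclusionInDoubleDual ℂ X b).comp
      (e.toContinuousLinearEquiv : M →L[ℂ] StrongDual ℂ X)‖ = _
    have h1 := (NormedSpace.inclusionInDoubleDual ℂ X b).opNorm_comp_linearIsometryEquiv e
    exact h1.trans ((NormedSpace.inclusionInDoubleDualLi ℂ).norm_map b)
  -- With the predual embedded in `M*` by `j`, restriction of bidual elements along `j` is the
  -- projection to which the hypothesis is applied.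
  let P : StrongDual ℂ (StrongDual ℂ M) →L[ℂ] M :=
    (e.symm.toContinuousLinearEquiv : StrongDual ℂ X →L[ℂ] M) ∘L
      ((ContinuousLinearMap.compL ℂ X (StrongDual ℂ M) ℂ).flip j)
  have hP : ∀ ξ, P ξ = e.symm (ξ ∘L j) := fun _ => rfl
  have hjle : ‖j‖ ≤ 1 := ContinuousLinearMap.opNorm_le_bound _ zero_le_one fun b => by
    rw [hjn, one_mul]
  have hS' := hS P (fun ξ => by
    rw [hP, LinearIsometryEquiv.norm_map]
    exact (ξ.opNorm_comp_le j).trans (mul_le_of_le_one_right (norm_nonneg ξ) hjle)) fun x => by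
      rw [hP, LinearIsometryEquiv.symm_apply_eq]
      ext b
      rfl
  -- Completeness of `X` enters here: the isometric image is closed, so Hahn-Banach can separate
  -- from it.
  let jl : X →ₗᵢ[ℂ] StrongDual ℂ M := ⟨j.toLinearMap, hjn⟩
  have hR : IsClosed (LinearMap.range j.toLinearMap : Set (StrongDual ℂ M)) :=
    jl.isometry.isClosedEmbedding.isClosed_range
  by_contra hne
  have hmem : j b ∘L S ∉ LinearMap.range j.toLinearMap := by
    rintro ⟨b', hb'⟩
    exact hne ⟨b', fun x => (congrArg (fun ℓ : StrongDual ℂ M => ℓ x) hb').symm⟩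
  obtain ⟨ξ, hξ, hξb⟩ := exists_dual_separating_submodule _ hR hmem
  have hξ0 : ξ ∘L j = 0 := by
    ext b'
    exact hξ _ ⟨b', rfl⟩
  have h1 := hS' ξ
  rw [hP, hP, hξ0, map_zero, map_zero, LinearIsometryEquiv.symm_apply_eq, map_zero] at h1
  exact hξb (congrArg (fun ℓ : StrongDual ℂ X => ℓ b) h1)

section Orthogonal

variable {A : Type*} [NormedRing A] [StarRing A] [CStarRing A]

/-- Expand the square by the C*-identity: the cross terms vanish, and the triangle inequality
applies to the diagonal. -/
theorem norm_sum_sq_le_of_star_mul_eq_zero {ι : Type*} (s : Finset ι) (z : ι → A)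
    (h : ∀ i ∈ s, ∀ j ∈ s, i ≠ j → star (z i) * z j = 0) :
    ‖∑ i ∈ s, z i‖ ^ 2 ≤ ∑ i ∈ s, ‖z i‖ ^ 2 := by
  rw [sq, ← CStarRing.norm_star_mul_self, star_sum, Finset.sum_mul_sum]
  have : ∑ i ∈ s, ∑ j ∈ s, star (z i) * z j = ∑ i ∈ s, star (z i) * z i :=
    Finset.sum_congr rfl fun i hi =>
      Finset.sum_eq_single_of_mem i hi fun j hj hji => h i hi j hj hji.symm
  rw [this]
  refine (norm_sum_le _ _).trans_eq (Finset.sum_congr rfl fun i _ => ?_)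
  rw [CStarRing.norm_star_mul_self, sq]

theorem norm_sum_sq_le_of_mul_star_eq_zero {ι : Type*} (s : Finset ι) (z : ι → A)
    (h : ∀ i ∈ s, ∀ j ∈ s, i ≠ j → z i * star (z j) = 0) :
    ‖∑ i ∈ s, z i‖ ^ 2 ≤ ∑ i ∈ s, ‖z i‖ ^ 2 := by
  have := norm_sum_sq_le_of_star_mul_eq_zero s (fun i => star (z i)) (by simpa using h)
  simpa [← star_sum] using this

end Orthogonal

/-! ### Multiplication in a W*-algebra -/

section CStar

variable {M : Type*} [CStarAlgebra M]

/-- The continuous functional calculus of `a`, acting by left multiplication. -/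
def cfcMulLeft {a : M} (ha : IsSelfAdjoint a) : C(spectrum ℝ a, ℝ) →ₗ[ℝ] (M →L[ℂ] M) :=
  ((ContinuousLinearMap.mul ℂ M).toLinearMap.restrictScalars ℝ) ∘ₗ
    (cfcHom ha : C(spectrum ℝ a, ℝ) →⋆ₐ[ℝ] M).toAlgHom.toLinearMap

/-- The continuous functional calculus of `a`, acting by right multiplication. -/
def cfcMulRight {a : M} (ha : IsSelfAdjoint a) : C(spectrum ℝ a, ℝ) →ₗ[ℝ] (M →L[ℂ] M) :=
  ((ContinuousLinearMap.mul ℂ M).flip.toLinearMap.restrictScalars ℝ) ∘ₗ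
    (cfcHom ha : C(spectrum ℝ a, ℝ) →⋆ₐ[ℝ] M).toAlgHom.toLinearMap

theorem cfcMulLeft_apply {a : M} (ha : IsSelfAdjoint a) (f : C(spectrum ℝ a, ℝ)) (x : M) :
    cfcMulLeft ha f x = cfcHom ha f * x := rfl

theorem cfcMulRight_apply {a : M} (ha : IsSelfAdjoint a) (f : C(spectrum ℝ a, ℝ)) (x : M) :
    cfcMulRight ha f x = x * cfcHom ha f := rfl

theorem star_cfcHom_real {a : M} (ha : IsSelfAdjoint a) (f : C(spectrum ℝ a, ℝ)) :
    star (cfcHom ha f) = cfcHom ha f := by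
  rw [← map_star]; congr 1

theorem isOrthogonalCalculus_cfcMulLeft {a : M} (ha : IsSelfAdjoint a) :
    IsOrthogonalCalculus (cfcMulLeft ha) where
  map_one := by ext x; simp [cfcMulLeft_apply]
  map_mul f g := by ext x; simp [cfcMulLeft_apply, mul_assoc]
  norm_le f := ContinuousLinearMap.opNorm_le_bound _ (norm_nonneg _) fun x => by
    rw [cfcMulLeft_apply, ← norm_cfcHom (𝕜 := ℝ) a f ha]
    exact norm_mul_le _ _
  norm_sum_sq_le s f x h := by
    refine norm_sum_sq_le_of_star_mul_eq_zero s _ fun i hi j hj hij => ?_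
    rw [cfcMulLeft_apply, cfcMulLeft_apply, star_mul, star_cfcHom_real, mul_assoc,
      ← mul_assoc (cfcHom ha (f i)), ← map_mul, h i hi j hj hij]
    simp

theorem isOrthogonalCalculus_cfcMulRight {a : M} (ha : IsSelfAdjoint a) :
    IsOrthogonalCalculus (cfcMulRight ha) where
  map_one := by ext x; simp [cfcMulRight_apply]
  map_mul f g := by ext x; rw [mul_comm]; simp [cfcMulRight_apply, mul_assoc]
  norm_le f := ContinuousLinearMap.opNorm_le_bound _ (norm_nonneg _) fun x => by
    rw [cfcMulRight_apply, ← norm_cfcHom (𝕜 := ℝ) a f ha, mul_comm]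
    exact norm_mul_le _ _
  norm_sum_sq_le s f x h := by
    refine norm_sum_sq_le_of_mul_star_eq_zero s _ fun i hi j hj hij => ?_
    rw [cfcMulRight_apply, cfcMulRight_apply, star_mul, star_cfcHom_real, mul_assoc,
      ← mul_assoc (cfcHom ha (f i)), ← map_mul, h i hi j hj hij]
    simp

variable {X : Type*} [NormedAddCommGroup X] [NormedSpace ℂ X] [CompleteSpace X]
  (e : M ≃ₗᵢ[ℂ] StrongDual ℂ X)

/-- If the left slices of a bilinear operation at positive contractions commute with the contractive
projections of the bidual onto `M`, then all its left slices are weak-* continuous. -/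
theorem exists_predual_of_nonneg (B : M →L[ℂ] M →L[ℂ] M)
    (hB : ∀ (a : M) (_ : IsSelfAdjoint a), (∀ k : spectrum ℝ a, 0 ≤ (k : ℝ) ∧ (k : ℝ) ≤ 1) →
      ∀ P : StrongDual ℂ (StrongDual ℂ M) →L[ℂ] M, (∀ ξ, ‖P ξ‖ ≤ ‖ξ‖) →
      (∀ x, P (NormedSpace.inclusionInDoubleDual ℂ M x) = x) →
      ∀ ξ, P (bidualMap (B a) ξ) = B a (P ξ)) (a : M) (b : X) :
    ∃ b' : X, ∀ x, e (B a x) b = e x b' := by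
  let _ := CStarAlgebra.spectralOrder M
  let _ := CStarAlgebra.spectralOrderedRing M
  -- The elements with weak-* continuous slice form a subspace, so a spanning set suffices.
  have hmem : a ∈ Submodule.span ℂ ({x : M | 0 ≤ x} ∩ Metric.closedBall 0 1) := by
    rw [CStarAlgebra.span_nonneg_inter_unitClosedBall]; trivial
  induction hmem using Submodule.span_induction with
  | mem a ha =>
    have hsa : IsSelfAdjoint a := IsSelfAdjoint.of_nonneg ha.1
    refine exists_predual_of_proj_bidualMap e (hB a hsa fun k => ⟨?_, ?_⟩) b
    · exact spectrum_nonneg_of_nonneg ha.1 k.2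
    · have h1 : ‖a‖ ≤ 1 := by simpa using ha.2
      have h2 := (CStarAlgebra.norm_le_one_iff_of_nonneg a ha.1).mp h1
      exact (CFC.le_one_iff (R := ℝ) a).mp h2 k k.2
  | zero => exact ⟨0, fun x => by simp⟩
  | add a a' _ _ h h' =>
    obtain ⟨b₁, h₁⟩ := h
    obtain ⟨b₂, h₂⟩ := h'
    exact ⟨b₁ + b₂, fun x => by simp [h₁, h₂]⟩
  | smul r a _ h =>
    obtain ⟨b₁, h₁⟩ := h
    exact ⟨r • b₁, fun x => by simp [h₁]⟩

/-- In a W*-algebra the left multiplications are weak-* continuous. -/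
theorem exists_predual_mul_left (a : M) (b : X) : ∃ b' : X, ∀ x, e (a * x) b = e x b' := by
  refine exists_predual_of_nonneg e (ContinuousLinearMap.mul ℂ M) (fun a ha hk P hP hPi ξ => ?_) a b
  have := (isOrthogonalCalculus_cfcMulLeft ha).proj_bidualMap hP hPi
    (u := (ContinuousMap.id ℝ).restrict (spectrum ℝ a)) (fun k => (hk k).1) (fun k => (hk k).2) ξ
  have h1 : cfcMulLeft ha ((ContinuousMap.id ℝ).restrict (spectrum ℝ a)) =
      ContinuousLinearMap.mul ℂ M a := by
    ext x
    rw [cfcMulLeft_apply, cfcHom_id]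
    rfl
  rwa [h1] at this

/-- In a W*-algebra the right multiplications are weak-* continuous. -/
theorem exists_predual_mul_right (a : M) (b : X) : ∃ b' : X, ∀ x, e (x * a) b = e x b' := by
  refine exists_predual_of_nonneg e (ContinuousLinearMap.mul ℂ M).flip
    (fun a ha hk P hP hPi ξ => ?_) a b
  have := (isOrthogonalCalculus_cfcMulRight ha).proj_bidualMap hP hPi
    (u := (ContinuousMap.id ℝ).restrict (spectrum ℝ a)) (fun k => (hk k).1) (fun k => (hk k).2) ξ
  have h1 : cfcMulRight ha ((ContinuousMap.id ℝ).restrict (spectrum ℝ a)) =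
      (ContinuousLinearMap.mul ℂ M).flip a := by
    ext x
    rw [cfcMulRight_apply, cfcHom_id]
    rfl
  rwa [h1] at this

end CStar

end WeakStar

/-! ### Lie-Poisson brackets from a bracket on the dual -/

section LiePoisson

set_option maxSynthPendingDepth 3

variable {𝕜 : Type*} [RCLike 𝕜] {E : Type*} [NormedAddCommGroup E] [NormedSpace 𝕜 E]

/-- The dual separates points, so the pointwise witnesses are unique and hence bilinear; it is also
norming, so they inherit the bound `‖B‖`. Continuity of `Λ` makes Hamiltonian vector fields smooth.
-/
theorem exists_coadjoint (B : StrongDual 𝕜 E →L[𝕜] StrongDual 𝕜 E →L[𝕜] StrongDual 𝕜 E)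
    (hB : ∀ k z, ∃ w : E, ∀ ℓ, ℓ w = B ℓ k z) :
    ∃ Λ : StrongDual 𝕜 E →L[𝕜] E →L[𝕜] E, ∀ ℓ k z, ℓ (Λ k z) = B ℓ k z := by
  choose w hw using hB
  refine ⟨LinearMap.mkContinuous₂ (LinearMap.mk₂ 𝕜 w ?_ ?_ ?_ ?_) ‖B‖ ?_, fun ℓ k z => hw k z ℓ⟩
  · intro k k' z
    exact (SeparatingDual.eq_iff_forall_dual_eq (R := 𝕜)).mpr fun ℓ => by simp [hw]
  · intro r k z
    exact (SeparatingDual.eq_iff_forall_dual_eq (R := 𝕜)).mpr fun ℓ => by simp [hw]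
  · intro k z z'
    exact (SeparatingDual.eq_iff_forall_dual_eq (R := 𝕜)).mpr fun ℓ => by simp [hw]
  · intro r k z
    exact (SeparatingDual.eq_iff_forall_dual_eq (R := 𝕜)).mpr fun ℓ => by simp [hw]
  · intro k z
    refine NormedSpace.norm_le_dual_bound 𝕜 _ (by positivity) fun ℓ => ?_
    rw [LinearMap.mk₂_apply, hw]
    calc ‖B ℓ k z‖ ≤ ‖B ℓ k‖ * ‖z‖ := (B ℓ k).le_opNorm z
      _ ≤ ‖B‖ * ‖ℓ‖ * ‖k‖ * ‖z‖ := by gcongr; exact B.le_opNorm₂ ℓ k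
      _ = ‖B‖ * ‖k‖ * ‖z‖ * ‖ℓ‖ := by ring

namespace SmoothFun

theorem differentiable (f : SmoothFun 𝕜 E) : Differentiable 𝕜 f.1 :=
  (show ContDiff 𝕜 ∞ f.1 from f.2).differentiable (by simp)

theorem contDiff_fderiv (f : SmoothFun 𝕜 E) : ContDiff 𝕜 ∞ (fderiv 𝕜 f.1) :=
  (show ContDiff 𝕜 ∞ f.1 from f.2).fderiv_right (by simp)

theorem differentiable_fderiv (f : SmoothFun 𝕜 E) : Differentiable 𝕜 (fderiv 𝕜 f.1) :=
  (SmoothFun.contDiff_fderiv f).differentiable (by simp)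

theorem fderiv_fderiv_comm (f : SmoothFun 𝕜 E) (z u v : E) :
    fderiv 𝕜 (fderiv 𝕜 f.1) z u v = fderiv 𝕜 (fderiv 𝕜 f.1) z v u :=
  (show ContDiff 𝕜 ∞ f.1 from f.2).contDiffAt.isSymmSndFDerivAt
    (by rw [minSmoothness_of_isRCLikeNormedField]; exact WithTop.coe_le_coe.mpr le_top) u v

theorem fderiv_add (f g : SmoothFun 𝕜 E) (z : E) :
    fderiv 𝕜 (f + g).1 z = fderiv 𝕜 f.1 z + fderiv 𝕜 g.1 z :=
  _root_.fderiv_add ((SmoothFun.differentiable f) z) ((SmoothFun.differentiable g) z)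

theorem fderiv_smul (r : 𝕜) (f : SmoothFun 𝕜 E) (z : E) :
    fderiv 𝕜 (r • f).1 z = r • fderiv 𝕜 f.1 z :=
  _root_.fderiv_const_smul ((SmoothFun.differentiable f) z) r

theorem fderiv_mul (f g : SmoothFun 𝕜 E) (z : E) :
    fderiv 𝕜 (f * g).1 z = f.1 z • fderiv 𝕜 g.1 z + g.1 z • fderiv 𝕜 f.1 z :=
  _root_.fderiv_mul ((SmoothFun.differentiable f) z) ((SmoothFun.differentiable g) z)

theorem fderiv_ofDual (ℓ : StrongDual 𝕜 E) (z : E) : fderiv 𝕜 (ofDual ℓ).1 z = ℓ :=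
  ℓ.fderiv

/-- The Lie-Poisson bracket of smooth functions defined by a bracket on the dual space. -/
def liePoissonBracket (B : StrongDual 𝕜 E →L[𝕜] StrongDual 𝕜 E →L[𝕜] StrongDual 𝕜 E)
    (f g : SmoothFun 𝕜 E) : SmoothFun 𝕜 E :=
  ⟨fun z => B (fderiv 𝕜 f.1 z) (fderiv 𝕜 g.1 z) z,
    ((B.contDiff.comp (SmoothFun.contDiff_fderiv f)).clm_apply (SmoothFun.contDiff_fderiv g)).clm_apply contDiff_id⟩

theorem liePoissonBracket_apply (B : StrongDual 𝕜 E →L[𝕜] StrongDual 𝕜 E →L[𝕜] StrongDual 𝕜 E)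
    (f g : SmoothFun 𝕜 E) (z : E) :
    (liePoissonBracket B f g).1 z = B (fderiv 𝕜 f.1 z) (fderiv 𝕜 g.1 z) z := rfl

theorem fderiv_liePoissonBracket
    (B : StrongDual 𝕜 E →L[𝕜] StrongDual 𝕜 E →L[𝕜] StrongDual 𝕜 E)
    (f g : SmoothFun 𝕜 E) (z u : E) :
    fderiv 𝕜 (liePoissonBracket B f g).1 z u =
      B (fderiv 𝕜 (fderiv 𝕜 f.1) z u) (fderiv 𝕜 g.1 z) z +
      B (fderiv 𝕜 f.1 z) (fderiv 𝕜 (fderiv 𝕜 g.1) z u) z +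
      B (fderiv 𝕜 f.1 z) (fderiv 𝕜 g.1 z) u := by
  have h1 := B.hasFDerivAt.comp z ((SmoothFun.differentiable_fderiv f) z).hasFDerivAt
  have h2 := (h1.clm_apply ((SmoothFun.differentiable_fderiv g) z).hasFDerivAt).clm_apply (hasFDerivAt_id z)
  have h3 := congrArg (fun L => L u) h2.fderiv
  refine Eq.trans h3 ?_
  simp
  ring

/-- Differentiating `{g, h}` along the Hamiltonian vector of `f` produces two Hessian terms and one
purely Lie algebraic term. `Λ` is what allows `B` with a Hessian argument to be read as that Hessian
evaluated on a vector. -/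
theorem liePoissonBracket_liePoissonBracket
    (B : StrongDual 𝕜 E →L[𝕜] StrongDual 𝕜 E →L[𝕜] StrongDual 𝕜 E)
    (Λ : StrongDual 𝕜 E →L[𝕜] E →L[𝕜] E) (hΛ : ∀ ℓ k z, ℓ (Λ k z) = B ℓ k z)
    (hanti : ∀ k l, B k l = -B l k) (f g h : SmoothFun 𝕜 E) (z : E) :
    (liePoissonBracket B f (liePoissonBracket B g h)).1 z =
      fderiv 𝕜 (fderiv 𝕜 h.1) z (Λ (fderiv 𝕜 f.1 z) z) (Λ (fderiv 𝕜 g.1 z) z) -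
      fderiv 𝕜 (fderiv 𝕜 g.1) z (Λ (fderiv 𝕜 f.1 z) z) (Λ (fderiv 𝕜 h.1 z) z) +
      B (fderiv 𝕜 f.1 z) (B (fderiv 𝕜 g.1 z) (fderiv 𝕜 h.1 z)) z := by
  rw [liePoissonBracket_apply, hanti, neg_apply, ← hΛ, fderiv_liePoissonBracket]
  generalize fderiv 𝕜 f.1 z = k
  have h1 := hΛ (fderiv 𝕜 (fderiv 𝕜 g.1) z (Λ k z)) (fderiv 𝕜 h.1 z) z
  have h2 := hΛ (fderiv 𝕜 (fderiv 𝕜 h.1) z (Λ k z)) (fderiv 𝕜 g.1 z) z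
  have h3 := congrArg (fun ℓ : StrongDual 𝕜 E => ℓ z)
    (hanti (fderiv 𝕜 g.1 z) (fderiv 𝕜 (fderiv 𝕜 h.1) z (Λ k z)))
  have h4 := hΛ (B (fderiv 𝕜 g.1 z) (fderiv 𝕜 h.1 z)) k z
  have h5 := congrArg (fun ℓ : StrongDual 𝕜 E => ℓ z)
    (hanti (B (fderiv 𝕜 g.1 z) (fderiv 𝕜 h.1 z)) k)
  simp only [neg_apply] at h3 h5
  linear_combination h1 - h3 - h2 - h4 - h5

/-- In the cyclic sum each Hessian occurs twice, with opposite signs and exchanged arguments.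
Symmetry of second derivatives cancels them, leaving Jacobi for `B` at the derivatives. -/
theorem liePoissonBracket_jacobi
    (B : StrongDual 𝕜 E →L[𝕜] StrongDual 𝕜 E →L[𝕜] StrongDual 𝕜 E)
    (hself : ∀ k, B k k = 0)
    (hjac : ∀ k l m, B k (B l m) + B l (B m k) + B m (B k l) = 0)
    (hB : ∀ k z, ∃ w : E, ∀ ℓ, ℓ w = B ℓ k z) (f g h : SmoothFun 𝕜 E) :
    liePoissonBracket B f (liePoissonBracket B g h) +
      liePoissonBracket B g (liePoissonBracket B h f) +
      liePoissonBracket B h (liePoissonBracket B f g) = 0 := by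
  obtain ⟨Λ, hΛ⟩ := exists_coadjoint B hB
  have hanti : ∀ k l, B k l = -B l k := fun k l => by
    have := hself (k + l)
    simp only [map_add, add_apply, hself, zero_add, add_zero] at this
    rw [add_comm] at this
    exact eq_neg_of_add_eq_zero_left this
  refine Subtype.ext <| funext fun z => ?_
  have hj := congrArg (fun ℓ : StrongDual 𝕜 E => ℓ z)
    (hjac (fderiv 𝕜 f.1 z) (fderiv 𝕜 g.1 z) (fderiv 𝕜 h.1 z))
  simp only [add_apply, zero_apply] at hj
  have k1 := liePoissonBracket_liePoissonBracket B Λ hΛ hanti f g h z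
  have k2 := liePoissonBracket_liePoissonBracket B Λ hΛ hanti g h f z
  have k3 := liePoissonBracket_liePoissonBracket B Λ hΛ hanti h f g z
  have e1 := fderiv_fderiv_comm f z (Λ (fderiv 𝕜 g.1 z) z) (Λ (fderiv 𝕜 h.1 z) z)
  have e2 := fderiv_fderiv_comm g z (Λ (fderiv 𝕜 h.1 z) z) (Λ (fderiv 𝕜 f.1 z) z)
  have e3 := fderiv_fderiv_comm h z (Λ (fderiv 𝕜 f.1 z) z) (Λ (fderiv 𝕜 g.1 z) z)
  refine (congrArg₂ (· + ·) (congrArg₂ (· + ·) k1 k2) k3).trans ?_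
  change _ = (0 : 𝕜)
  linear_combination hj + e1 + e2 + e3

/-- `liePoissonBracket` as a bilinear map. -/
def liePoissonBracketₗ (B : StrongDual 𝕜 E →L[𝕜] StrongDual 𝕜 E →L[𝕜] StrongDual 𝕜 E) :
    SmoothFun 𝕜 E →ₗ[𝕜] SmoothFun 𝕜 E →ₗ[𝕜] SmoothFun 𝕜 E :=
  LinearMap.mk₂ 𝕜 (liePoissonBracket B)
    (fun f f' g => Subtype.ext <| funext fun z => by
      rw [liePoissonBracket_apply, fderiv_add, map_add]; rfl)
    (fun r f g => Subtype.ext <| funext fun z => by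
      rw [liePoissonBracket_apply, fderiv_smul, map_smul]; rfl)
    (fun f g g' => Subtype.ext <| funext fun z => by
      rw [liePoissonBracket_apply, fderiv_add, map_add]; rfl)
    (fun r f g => Subtype.ext <| funext fun z => by
      rw [liePoissonBracket_apply, fderiv_smul, map_smul]; rfl)

theorem liePoissonBracket_mul (B : StrongDual 𝕜 E →L[𝕜] StrongDual 𝕜 E →L[𝕜] StrongDual 𝕜 E)
    (f g h : SmoothFun 𝕜 E) : liePoissonBracket B (f * g) h =
      f * liePoissonBracket B g h + liePoissonBracket B f h * g := by
  refine Subtype.ext <| funext fun z => ?_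
  have h1 : B (fderiv 𝕜 (f * g).1 z) (fderiv 𝕜 h.1 z) z =
      f.1 z * B (fderiv 𝕜 g.1 z) (fderiv 𝕜 h.1 z) z +
        g.1 z * B (fderiv 𝕜 f.1 z) (fderiv 𝕜 h.1 z) z := by
    rw [fderiv_mul, map_add, map_smul, map_smul]; rfl
  refine h1.trans ?_
  rw [mul_comm (g.1 z)]
  rfl

end SmoothFun

/-- The Poisson structure given by a Lie bracket on the dual space whose coadjoint action preserves
the predual. -/
def PoissonStructure.ofDualBracket
    (B : StrongDual 𝕜 E →L[𝕜] StrongDual 𝕜 E →L[𝕜] StrongDual 𝕜 E)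
    (hself : ∀ k, B k k = 0)
    (hjac : ∀ k l m, B k (B l m) + B l (B m k) + B m (B k l) = 0)
    (hB : ∀ k z, ∃ w : E, ∀ ℓ, ℓ w = B ℓ k z) : PoissonStructure 𝕜 E where
  bracket := SmoothFun.liePoissonBracketₗ B
  bracket_self f := Subtype.ext <| funext fun z =>
    congrArg (fun ℓ : StrongDual 𝕜 E => ℓ z) (hself (fderiv 𝕜 f.1 z))
  jacobi := SmoothFun.liePoissonBracket_jacobi B hself hjac hB
  leibniz := SmoothFun.liePoissonBracket_mul B
  exists_vectorField h := by
    obtain ⟨Λ, hΛ⟩ := exists_coadjoint B hB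
    exact ⟨fun z => Λ (fderiv 𝕜 h.1 z) z,
      (Λ.contDiff.comp (SmoothFun.contDiff_fderiv h)).clm_apply contDiff_id, fun f z => (hΛ _ _ _).symm⟩

theorem PoissonStructure.ofDualBracket_bracket
    (B : StrongDual 𝕜 E →L[𝕜] StrongDual 𝕜 E →L[𝕜] StrongDual 𝕜 E)
    (hself hjac hB) (f g : SmoothFun 𝕜 E) :
    (PoissonStructure.ofDualBracket B hself hjac hB).bracket f g =
      SmoothFun.liePoissonBracket B f g := rfl

end LiePoisson

/-! ### The semidirect product structure -/

section Semidirect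

set_option maxSynthPendingDepth 3

variable {𝕜 : Type*} [RCLike 𝕜]
  {n c h a : Type*} [NormedAddCommGroup n] [NormedSpace 𝕜 n]
  [NormedAddCommGroup c] [NormedSpace 𝕜 c] [NormedRing h] [NormedAlgebra 𝕜 h]
  [NormedAddCommGroup a] [NormedSpace 𝕜 a]
  (κ : n ≃ₗᵢ[𝕜] StrongDual 𝕜 c) (ε : h ≃ₗᵢ[𝕜] StrongDual 𝕜 a)

/-- The component in `n` of a functional on `c × a`. -/
def dualFst : StrongDual 𝕜 (c × a) →L[𝕜] n :=
  (κ.symm.toContinuousLinearEquiv : StrongDual 𝕜 c →L[𝕜] n) ∘L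
    ((ContinuousLinearMap.compL 𝕜 c (c × a) 𝕜).flip (ContinuousLinearMap.inl 𝕜 c a))

/-- The component in `h` of a functional on `c × a`. -/
def dualSnd : StrongDual 𝕜 (c × a) →L[𝕜] h :=
  (ε.symm.toContinuousLinearEquiv : StrongDual 𝕜 a →L[𝕜] h) ∘L
    ((ContinuousLinearMap.compL 𝕜 a (c × a) 𝕜).flip (ContinuousLinearMap.inr 𝕜 c a))

theorem apply_dualFst (ℓ : StrongDual 𝕜 (c × a)) (v : c) : κ (dualFst κ ℓ) v = ℓ (v, 0) := by
  change κ (κ.symm _) v = _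
  rw [LinearIsometryEquiv.apply_symm_apply]; rfl

theorem apply_dualSnd (ℓ : StrongDual 𝕜 (c × a)) (b : a) : ε (dualSnd ε ℓ) b = ℓ (0, b) := by
  change ε (ε.symm _) b = _
  rw [LinearIsometryEquiv.apply_symm_apply]; rfl

theorem pairDual_apply (ζ : n) (η : h) (z : c × a) :
    pairDual κ ε ζ η z = κ ζ z.1 + ε η z.2 := rfl

theorem pairDual_dualFst_dualSnd (ℓ : StrongDual 𝕜 (c × a)) :
    pairDual κ ε (dualFst κ ℓ) (dualSnd ε ℓ) = ℓ := by
  refine ContinuousLinearMap.ext fun z => ?_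
  rw [pairDual_apply, apply_dualFst, apply_dualSnd, ← map_add]
  simp

theorem dualFst_pairDual (ζ : n) (η : h) : dualFst κ (pairDual κ ε ζ η) = ζ := by
  apply κ.injective
  ext v
  rw [apply_dualFst, pairDual_apply]; simp

theorem dualSnd_pairDual (ζ : n) (η : h) : dualSnd ε (pairDual κ ε ζ η) = η := by
  apply ε.injective
  ext v
  rw [apply_dualSnd, pairDual_apply]; simp

theorem dualFst_fderiv (f : SmoothFun 𝕜 (c × a)) (z : c × a) :
    dualFst κ (fderiv 𝕜 f.1 z) = derivFst κ f z := by
  have h1 : HasFDerivAt (fun v : c => (v, z.2)) (ContinuousLinearMap.inl 𝕜 c a) z.1 :=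
    hasFDerivAt_prodMk_left z.1 z.2
  have h2 := (((SmoothFun.differentiable f) z).hasFDerivAt.comp (f := fun v : c => (v, z.2)) z.1 h1).fderiv
  change κ.symm _ = κ.symm _
  congr 1
  exact h2.symm

theorem dualSnd_fderiv (f : SmoothFun 𝕜 (c × a)) (z : c × a) :
    dualSnd ε (fderiv 𝕜 f.1 z) = derivSnd ε f z := by
  have h1 : HasFDerivAt (fun b : a => (z.1, b)) (ContinuousLinearMap.inr 𝕜 c a) z.2 :=
    hasFDerivAt_prodMk_right z.1 z.2
  have h2 := (((SmoothFun.differentiable f) z).hasFDerivAt.comp (f := fun b : a => (z.1, b)) z.2 h1).fderiv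
  change ε.symm _ = ε.symm _
  congr 1
  exact h2.symm

variable {φ : h → n → n}

theorem exists_semidirectBracket (hφ : IsLieRepresentation 𝕜 φ) :
    ∃ B : StrongDual 𝕜 (c × a) →L[𝕜] StrongDual 𝕜 (c × a) →L[𝕜] StrongDual 𝕜 (c × a),
      ∀ k l, B k l = pairDual κ ε
        (φ (dualSnd ε k) (dualFst κ l) - φ (dualSnd ε l) (dualFst κ k))
        ⁅dualSnd ε k, dualSnd ε l⁆ := by
  let Φ : h →L[𝕜] n →L[𝕜] n := hφ.bounded.toContinuousLinearMap
  let mu : h →L[𝕜] h →L[𝕜] h := ContinuousLinearMap.mul 𝕜 h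
  let D : StrongDual 𝕜 (c × a) →L[𝕜] StrongDual 𝕜 (c × a) →L[𝕜] n :=
    Φ.bilinearComp (dualSnd ε) (dualFst κ)
  let C : StrongDual 𝕜 (c × a) →L[𝕜] StrongDual 𝕜 (c × a) →L[𝕜] h :=
    mu.bilinearComp (dualSnd ε) (dualSnd ε)
  let I₁ : n →L[𝕜] StrongDual 𝕜 (c × a) :=
    ((ContinuousLinearMap.compL 𝕜 (c × a) c 𝕜).flip (ContinuousLinearMap.fst 𝕜 c a)) ∘L
      (κ.toContinuousLinearEquiv : n →L[𝕜] StrongDual 𝕜 c)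
  let I₂ : h →L[𝕜] StrongDual 𝕜 (c × a) :=
    ((ContinuousLinearMap.compL 𝕜 (c × a) a 𝕜).flip (ContinuousLinearMap.snd 𝕜 c a)) ∘L
      (ε.toContinuousLinearEquiv : h →L[𝕜] StrongDual 𝕜 a)
  refine ⟨ContinuousLinearMap.compL 𝕜 _ _ _ I₁ ∘L (D - D.flip) +
    ContinuousLinearMap.compL 𝕜 _ _ _ I₂ ∘L (C - C.flip), fun k l => ?_⟩
  refine ContinuousLinearMap.ext fun z => ?_
  rfl

/-- The semidirect conditions together with `had` say exactly what is needed for the coadjoint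
action of the semidirect product to preserve `c × a`. Jacobi splits into `map_lie` on `n` and the
commutator identity on `h`. -/
theorem exists_isSemidirectLiePoisson (hφ : IsLieRepresentation 𝕜 φ)
    (hc : SemidirectConditions κ ε φ)
    (had : ∀ (η : h) (b : a), ∃ b' : a, ∀ η', ε ⁅η', η⁆ b = ε η' b') :
    ∃ P : PoissonStructure 𝕜 (c × a), IsSemidirectLiePoisson κ ε φ P := by
  obtain ⟨B, hB⟩ := exists_semidirectBracket κ ε hφ
  have hadd : ∀ η ζ ζ', φ η (ζ + ζ') = φ η ζ + φ η ζ' := fun η => hφ.bounded.add_right η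
  have hneg : ∀ η ζ, φ η (-ζ) = -φ η ζ := fun η ζ =>
    (hφ.bounded.toContinuousLinearMap η).map_neg ζ
  have hsub : ∀ η ζ ζ', φ η (ζ - ζ') = φ η ζ - φ η ζ' := fun η ζ ζ' => by
    rw [sub_eq_add_neg, hadd, hneg, ← sub_eq_add_neg]
  have hself : ∀ k, B k k = 0 := fun k => by
    rw [hB, sub_self, Ring.lie_def, sub_self]
    refine ContinuousLinearMap.ext fun z => ?_
    simp [pairDual_apply]
  have hjac : ∀ k l m, B k (B l m) + B l (B m k) + B m (B k l) = 0 := fun k l m => by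
    simp only [hB, dualFst_pairDual, dualSnd_pairDual]
    refine ContinuousLinearMap.ext fun z => ?_
    simp only [add_apply, pairDual_apply, zero_apply]
    have h1 : ∀ A₁ A₂ A₃ C₁ C₂ C₃ : 𝕜, A₁ + A₂ + A₃ = 0 → C₁ + C₂ + C₃ = 0 →
        A₁ + C₁ + (A₂ + C₂) + (A₃ + C₃) = 0 := fun _ _ _ _ _ _ h h' => by
      linear_combination h + h'
    refine h1 _ _ _ _ _ _ ?_ ?_
    · rw [← add_apply, ← map_add, ← add_apply, ← map_add]
      have : ∀ ζ : n, ζ = 0 → κ ζ z.1 = 0 := by rintro _ rfl; simp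
      refine this _ ?_
      simp only [hφ.map_lie, hsub]
      abel
    · rw [← add_apply, ← map_add, ← add_apply, ← map_add]
      have : ∀ η : h, η = 0 → ε η z.2 = 0 := by rintro _ rfl; simp
      refine this _ ?_
      simp only [Ring.lie_def]
      noncomm_ring
  have hpre : ∀ k z, ∃ w : c × a, ∀ ℓ, ℓ w = B ℓ k z := fun k z => by
    obtain ⟨v', hv'⟩ := hc.left (dualSnd ε k) z.1
    obtain ⟨b₁, hb₁⟩ := hc.right (dualFst κ k) z.1
    obtain ⟨b₂, hb₂⟩ := had (dualSnd ε k) z.2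
    -- As `k` is the second argument of `B ℓ k`, its `h`-component acts on the `n`-component of `ℓ`
    -- with a minus sign; the other two terms depend on `ℓ` through its `h`-component.
    refine ⟨(-v', b₁ + b₂), fun ℓ => ?_⟩
    conv_lhs => rw [← pairDual_dualFst_dualSnd κ ε ℓ]
    rw [hB, pairDual_apply, pairDual_apply, map_sub, sub_apply, hv', hb₁, hb₂]
    simp
    ring
  refine ⟨PoissonStructure.ofDualBracket B hself hjac hpre, ⟨⟨B, fun x y => ?_⟩, ?_, ?_, ?_⟩⟩
  · refine Subtype.ext <| funext fun z => ?_
    rw [PoissonStructure.ofDualBracket_bracket, SmoothFun.liePoissonBracket_apply,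
      SmoothFun.fderiv_ofDual, SmoothFun.fderiv_ofDual]
    rfl
  · intro ζ η ζ' η'
    refine Subtype.ext <| funext fun z => ?_
    rw [PoissonStructure.ofDualBracket_bracket, SmoothFun.liePoissonBracket_apply,
      SmoothFun.fderiv_ofDual, SmoothFun.fderiv_ofDual, hB]
    simp only [dualFst_pairDual, dualSnd_pairDual]
    rfl
  · intro f g z
    rw [PoissonStructure.ofDualBracket_bracket, SmoothFun.liePoissonBracket_apply, hB,
      pairDual_apply, dualFst_fderiv, dualFst_fderiv, dualSnd_fderiv, dualSnd_fderiv, add_comm]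
  · intro H
    obtain ⟨Λ, hΛ⟩ := exists_coadjoint B hpre
    refine ⟨fun z => Λ (fderiv 𝕜 H.1 z) z,
      (Λ.contDiff.comp (SmoothFun.contDiff_fderiv H)).clm_apply contDiff_id, fun f z => (hΛ _ _ _).symm,
      fun z => ⟨fun ζ => ?_, fun η => ?_⟩⟩
    · have h1 := hΛ (pairDual κ ε ζ 0) (fderiv 𝕜 H.1 z) z
      rw [hB, pairDual_apply, pairDual_apply, dualFst_pairDual, dualSnd_pairDual,
        dualSnd_fderiv] at h1
      have h0 : ∀ ζ, φ 0 ζ = 0 := fun ζ => by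
        simpa using hφ.bounded.smul_left 0 0 ζ
      simpa [h0, Ring.lie_def] using h1
    · have h1 := hΛ (pairDual κ ε 0 η) (fderiv 𝕜 H.1 z) z
      rw [hB, pairDual_apply, pairDual_apply, dualFst_pairDual, dualSnd_pairDual,
        dualSnd_fderiv, dualFst_fderiv] at h1
      have h0 : ∀ η, φ η 0 = 0 := fun η => (hφ.bounded.toContinuousLinearMap η).map_zero
      have h2 : ε ⁅η, derivSnd ε H z⁆ z.2 = -ε ⁅derivSnd ε H z, η⁆ z.2 := by
        rw [← neg_apply, ← map_neg, Ring.lie_def, Ring.lie_def, neg_sub]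
      rw [h2] at h1
      simpa [h0, sub_eq_add_neg] using h1

variable {κ ε} in
theorem IsSemidirectLiePoisson.unique {P Q : PoissonStructure 𝕜 (c × a)}
    (hP : IsSemidirectLiePoisson κ ε φ P) (hQ : IsSemidirectLiePoisson κ ε φ Q) : P = Q := by
  ext f g z
  exact (hP.bracket_eq f g z).trans (hQ.bracket_eq f g z).symm

end Semidirect

/-! ### Trace class operators as the predual of the bounded operators -/

section TraceClassTheory

open InnerProductSpace

variable {H : Type*} [NormedAddCommGroup H] [InnerProductSpace ℂ H]

theorem IsNuclearExpansion.reindex {ι : Type*} (ε : ℕ ≃ ι) {T : H →L[ℂ] H} {x y : ι → H}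
    (h1 : Summable fun i => ‖x i‖ * ‖y i‖) (h2 : HasSum (fun i => rankOne ℂ (x i) (y i)) T) :
    IsNuclearExpansion T (x ∘ ε) (y ∘ ε) ∧
      ∑' k, ‖(x ∘ ε) k‖ * ‖(y ∘ ε) k‖ = ∑' i, ‖x i‖ * ‖y i‖ :=
  ⟨⟨(ε.summable_iff (f := fun i => ‖x i‖ * ‖y i‖)).mpr h1,
    (ε.hasSum_iff (f := fun i => rankOne ℂ (x i) (y i))).mpr h2⟩, ε.tsum_eq fun i => ‖x i‖ * ‖y i‖⟩

namespace TraceClass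

theorem ext_toCLM {S T : TraceClass H} (h : S.toCLM = T.toCLM) : S = T := Subtype.ext h

theorem toCLM_add (S T : TraceClass H) : (S + T).toCLM = S.toCLM + T.toCLM := rfl

theorem toCLM_smul (r : ℂ) (T : TraceClass H) : (r • T).toCLM = r • T.toCLM := rfl

variable (H) in
/-- The inclusion of the trace class operators into the bounded operators. -/
def toCLML : TraceClass H →L[ℂ] H →L[ℂ] H :=
  LinearMap.mkContinuous { toFun := toCLM, map_add' := toCLM_add, map_smul' := toCLM_smul } 1
    fun T => by rw [one_mul]; exact norm_toCLM_le T

theorem toCLML_apply (T : TraceClass H) : toCLML H T = T.toCLM := rfl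

theorem exists_expansion_lt (T : TraceClass H) {r : ℝ} (hr : 0 < r) :
    ∃ x y, IsNuclearExpansion T.toCLM x y ∧ ∑' k, ‖x k‖ * ‖y k‖ < ‖T‖ + r := by
  by_contra! h
  have := le_norm (T := T) (r := ‖T‖ + r) fun x y hxy => h x y hxy
  linarith

theorem isNuclearExpansion_rankOne (x y : H) :
    IsNuclearExpansion (rankOne ℂ x y) (Pi.single 0 x) (Pi.single 0 y) := by
  refine ⟨summable_of_ne_finset_zero (s := {0}) fun k hk => ?_, ?_⟩
  · simp [Pi.single_eq_of_ne (by simpa using hk : k ≠ 0)]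
  · have := hasSum_single (f := fun k => rankOne ℂ ((Pi.single 0 x : ℕ → H) k)
      ((Pi.single 0 y : ℕ → H) k)) 0 fun k hk => by simp [Pi.single_eq_of_ne hk]
    simpa using this

/-- The operator `|x⟩⟨y|` as a trace class operator. -/
def rankOneOp (x y : H) : TraceClass H :=
  ⟨rankOne ℂ x y, Pi.single 0 x, Pi.single 0 y, isNuclearExpansion_rankOne x y⟩

theorem toCLM_rankOneOp (x y : H) : (rankOneOp x y).toCLM = rankOne ℂ x y := rfl

theorem norm_rankOneOp_le (x y : H) : ‖rankOneOp x y‖ ≤ ‖x‖ * ‖y‖ := by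
  refine (norm_le (T := rankOneOp x y) (isNuclearExpansion_rankOne x y)).trans_eq ?_
  rw [tsum_eq_single 0 fun k hk => by simp [Pi.single_eq_of_ne hk]]
  simp

variable [CompleteSpace H]

/-- A series of nuclear expansions with summable bounds sums up to a trace class operator. -/
theorem exists_hasSum_of_expansions {S : ℕ → H →L[ℂ] H} {x y : ℕ → ℕ → H}
    (hS : ∀ n, IsNuclearExpansion (S n) (x n) (y n))
    (hsum : Summable fun n => ∑' k, ‖x n k‖ * ‖y n k‖) :
    ∃ T : TraceClass H, HasSum S T.toCLM ∧ ‖T‖ ≤ ∑' n, ∑' k, ‖x n k‖ * ‖y n k‖ := by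
  have h1 : Summable fun p : ℕ × ℕ => ‖x p.1 p.2‖ * ‖y p.1 p.2‖ :=
    (summable_prod_of_nonneg fun p => by positivity).mpr ⟨fun n => (hS n).summable, hsum⟩
  have h2 : Summable fun p : ℕ × ℕ => rankOne ℂ (x p.1 p.2) (y p.1 p.2) :=
    Summable.of_norm (by simpa using h1)
  obtain ⟨h3, h4⟩ := IsNuclearExpansion.reindex Nat.pairEquiv.symm
    (x := fun p : ℕ × ℕ => x p.1 p.2) (y := fun p : ℕ × ℕ => y p.1 p.2) h1 h2.hasSum
  let T : TraceClass H := ⟨_, _, _, h3⟩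
  refine ⟨T, h2.hasSum.prod_fiberwise fun n => (hS n).hasSum, ?_⟩
  refine (norm_le (T := T) h3).trans_eq (h4.trans ?_)
  exact h1.tsum_prod' fun n => (hS n).summable

instance completeSpace : CompleteSpace (TraceClass H) := by
  refine NormedAddCommGroup.completeSpace_of_summable_imp_tendsto fun u hu => ?_
  -- Geometric slack keeps the costs of near-optimal expansions summable, so the tails can be merged
  -- into single expansions of small cost.
  choose x y hxy hlt using fun n => exists_expansion_lt (u n) (r := (1 / 2) ^ n) (by positivity)
  have hc : Summable fun n => ∑' k, ‖x n k‖ * ‖y n k‖ :=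
    Summable.of_nonneg_of_le (fun n => tsum_nonneg fun k => by positivity) (fun n => (hlt n).le)
      (hu.add summable_geometric_two)
  obtain ⟨T, hT, -⟩ := exists_hasSum_of_expansions hxy hc
  refine ⟨T, ?_⟩
  rw [tendsto_iff_norm_sub_tendsto_zero]
  have htail := tendsto_sum_nat_add fun n => ∑' k, ‖x n k‖ * ‖y n k‖
  refine squeeze_zero (fun _ => norm_nonneg _) (fun N => ?_) htail
  obtain ⟨R, hR, hRn⟩ := exists_hasSum_of_expansions (fun n => hxy (n + N))
    ((summable_nat_add_iff N).mpr hc)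
  have h1 : T - ∑ i ∈ Finset.range N, u i = R := by
    refine ext_toCLM ?_
    have h2 := (hasSum_nat_add_iff' N).mpr hT
    rw [hR.unique h2, ← toCLML_apply, map_sub, map_sum]
    rfl
  rw [norm_sub_rev, h1]
  exact hRn

/-- The series converges absolutely in trace norm, and its limit is identified in operator norm.
Hence a continuous functional on `TraceClass H` is determined by its values on rank one operators.
-/
theorem hasSum_rankOneOp {T : TraceClass H} {x y : ℕ → H} (h : IsNuclearExpansion T.toCLM x y) :
    HasSum (fun k => rankOneOp (x k) (y k)) T := by
  have h1 : Summable fun k => rankOneOp (x k) (y k) :=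
    Summable.of_norm_bounded h.summable fun k => norm_rankOneOp_le _ _
  have h2 : HasSum (fun k => toCLML H (rankOneOp (x k) (y k)))
      (toCLML H (∑' k, rankOneOp (x k) (y k))) := (toCLML H).hasSum h1.hasSum
  have h3 : HasSum (fun k => toCLML H (rankOneOp (x k) (y k))) (toCLML H T) := h.hasSum
  rw [← ext_toCLM (h2.unique h3)]
  exact h1.hasSum

end TraceClass

variable [CompleteSpace H]

theorem rankOne_comp_eq (x y : H) (A : H →L[ℂ] H) :
    rankOne ℂ x y ∘L A = rankOne ℂ x (ContinuousLinearMap.adjoint A y) := by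
  ext z
  simp [ContinuousLinearMap.adjoint_inner_left]

theorem IsNuclearExpansion.comp_right {T : H →L[ℂ] H} {x y : ℕ → H}
    (hT : IsNuclearExpansion T x y) (A : H →L[ℂ] H) :
    IsNuclearExpansion (T ∘L A) x fun k => ContinuousLinearMap.adjoint A (y k) := by
  refine ⟨Summable.of_nonneg_of_le (fun k => by positivity) (fun k => ?_)
    (hT.summable.mul_left ‖A‖), ?_⟩
  · calc ‖x k‖ * ‖ContinuousLinearMap.adjoint A (y k)‖ ≤ ‖x k‖ * (‖A‖ * ‖y k‖) := by
          gcongr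
          rw [← LinearIsometryEquiv.norm_map ContinuousLinearMap.adjoint A]
          exact ContinuousLinearMap.le_opNorm _ _
      _ = _ := by ring
  · have := ((ContinuousLinearMap.compL ℂ H H H).flip A).hasSum hT.hasSum
    simpa only [ContinuousLinearMap.flip_apply, ContinuousLinearMap.compL_apply,
      rankOne_comp_eq] using this

-- Cauchy-Schwarz on finite sums, followed by Bessel's inequality for each factor.
omit [CompleteSpace H] in
theorem summable_norm_inner_mul_inner {ι : Type*} {b : ι → H} (hb : Orthonormal ℂ b) (x y : H) :
    Summable (fun i => ‖inner ℂ y (b i) * inner ℂ (b i) x‖) ∧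
      ∑' i, ‖inner ℂ y (b i) * inner ℂ (b i) x‖ ≤ ‖x‖ * ‖y‖ := by
  have key : ∀ s : Finset ι, ∑ i ∈ s, ‖inner ℂ y (b i) * inner ℂ (b i) x‖ ≤ ‖x‖ * ‖y‖ := by
    intro s
    have h1 : ∀ i, ‖inner ℂ y (b i) * inner ℂ (b i) x‖ = ‖inner ℂ (b i) x‖ * ‖inner ℂ (b i) y‖ :=
      fun i => by rw [norm_mul, norm_inner_symm, mul_comm]
    simp only [h1]
    refine (Real.sum_mul_le_sqrt_mul_sqrt s _ _).trans ?_
    gcongr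
    · exact Real.sqrt_le_iff.mpr ⟨norm_nonneg _, hb.sum_inner_products_le x⟩
    · exact Real.sqrt_le_iff.mpr ⟨norm_nonneg _, hb.sum_inner_products_le y⟩
  have h2 := summable_of_sum_le (fun i => norm_nonneg _) key
  exact ⟨h2, h2.tsum_le_of_sum_le key⟩

omit [CompleteSpace H] in
/-- The trace of a nuclear operator can be computed in any Hilbert basis. -/
theorem IsNuclearExpansion.hasSum_inner {T : H →L[ℂ] H} {x y : ℕ → H}
    (hT : IsNuclearExpansion T x y) {ι : Type*} (b : HilbertBasis ι ℂ H) :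
    HasSum (fun i => inner ℂ (b i) (T (b i))) (∑' k, inner ℂ (y k) (x k)) := by
  -- This double series converges absolutely. Summing over the basis first gives `inner ℂ (y k) (x
  -- k)` by Parseval; summing over the expansion first gives the diagonal entries of `T`.
  let F : ℕ × ι → ℂ := fun p => inner ℂ (y p.1) (b p.2) * inner ℂ (b p.2) (x p.1)
  have h1 : Summable fun p => ‖F p‖ := by
    refine (summable_prod_of_nonneg fun p => norm_nonneg _).mpr
      ⟨fun k => (summable_norm_inner_mul_inner b.orthonormal (x k) (y k)).1, ?_⟩
    exact Summable.of_nonneg_of_le (fun k => tsum_nonneg fun i => norm_nonneg _)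
      (fun k => (summable_norm_inner_mul_inner b.orthonormal (x k) (y k)).2) hT.summable
  have h2 := h1.of_norm.hasSum
  have h3 : HasSum (fun k => inner ℂ (y k) (x k)) (∑' p, F p) :=
    h2.prod_fiberwise fun k => b.hasSum_inner_mul_inner (y k) (x k)
  rw [h3.tsum_eq]
  have h4 : HasSum (fun p : ι × ℕ => F p.swap) (∑' p, F p) :=
    (Equiv.prodComm ι ℕ).hasSum_iff.mpr h2
  refine h4.prod_fiberwise fun i => ?_
  have := ((innerSL ℂ (b i)) ∘L (ContinuousLinearMap.apply ℂ H (b i))).hasSum hT.hasSum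
  simpa [F, Function.comp_def] using this

theorem IsNuclearExpansion.opTrace_eq {T : H →L[ℂ] H} {x y : ℕ → H}
    (hT : IsNuclearExpansion T x y) : opTrace T = ∑' k, inner ℂ (y k) (x k) := by
  obtain ⟨b, hb⟩ := (exists_hilbertBasis ℂ H).choose_spec
  have := hT.hasSum_inner b
  rw [hb] at this
  exact this.tsum_eq

theorem opTrace_rankOne (x y : H) : opTrace (rankOne ℂ x y) = inner ℂ y x := by
  rw [(TraceClass.isNuclearExpansion_rankOne x y).opTrace_eq,
    tsum_eq_single 0 fun k hk => by simp [Pi.single_eq_of_ne hk]]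
  simp

theorem opTrace_rankOne_comp (x y : H) (A : H →L[ℂ] H) :
    opTrace (rankOne ℂ x y ∘L A) = inner ℂ y (A x) := by
  rw [rankOne_comp_eq, opTrace_rankOne, ContinuousLinearMap.adjoint_inner_left]

namespace TraceClass

theorem hasSum_inner (A : H →L[ℂ] H) (ρ : TraceClass H) {ι : Type*} (b : HilbertBasis ι ℂ H) :
    HasSum (fun i => inner ℂ (b i) (ρ.toCLM (A (b i)))) (opTrace (ρ.toCLM ∘L A)) := by
  obtain ⟨x, y, h⟩ := ρ.2
  have h' := IsNuclearExpansion.comp_right (T := ρ.toCLM) h A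
  rw [h'.opTrace_eq]
  exact h'.hasSum_inner b

theorem opTrace_eq_of_hasSum {T : H →L[ℂ] H} {t : ℂ}
    (h : ∀ (s : Set H) (b : HilbertBasis s ℂ H), HasSum (fun i => inner ℂ (b i) (T (b i))) t) :
    opTrace T = t := by
  obtain ⟨b, hb⟩ := (exists_hilbertBasis ℂ H).choose_spec
  have := h _ b
  rw [hb] at this
  exact this.tsum_eq

theorem norm_opTrace_comp_le (A : H →L[ℂ] H) (ρ : TraceClass H) :
    ‖opTrace (ρ.toCLM ∘L A)‖ ≤ ‖A‖ * ‖ρ‖ := by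
  have key : ∀ x y, IsNuclearExpansion ρ.toCLM x y →
      ‖opTrace (ρ.toCLM ∘L A)‖ ≤ ‖A‖ * ∑' k, ‖x k‖ * ‖y k‖ := by
    intro x y h
    rw [(h.comp_right A).opTrace_eq, ← tsum_mul_left]
    refine tsum_of_norm_bounded (h.summable.mul_left ‖A‖).hasSum fun k => ?_
    rw [ContinuousLinearMap.adjoint_inner_left]
    calc ‖inner ℂ (y k) (A (x k))‖ ≤ ‖y k‖ * ‖A (x k)‖ := norm_inner_le_norm _ _
      _ ≤ ‖y k‖ * (‖A‖ * ‖x k‖) := by gcongr; exact A.le_opNorm _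
      _ = _ := by ring
  rcases (norm_nonneg A).eq_or_lt with h0 | h0
  · obtain ⟨x, y, h⟩ := ρ.2
    simpa [← h0] using key x y h
  · rw [← div_le_iff₀' h0]
    refine le_norm fun x y h => ?_
    rw [div_le_iff₀' h0]
    exact key x y h

/-- The functional `ρ ↦ tr (ρ A)` on the trace class operators. -/
def traceFunctional (A : H →L[ℂ] H) : StrongDual ℂ (TraceClass H) :=
  LinearMap.mkContinuous
    { toFun := fun ρ => opTrace (ρ.toCLM ∘L A)
      map_add' := fun ρ σ => opTrace_eq_of_hasSum fun s b => by
        simpa [toCLM_add, inner_add_right] using (ρ.hasSum_inner A b).add (σ.hasSum_inner A b)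
      map_smul' := fun r ρ => opTrace_eq_of_hasSum fun s b => by
        simpa [toCLM_smul, inner_smul_right] using (ρ.hasSum_inner A b).mul_left r }
    ‖A‖ (norm_opTrace_comp_le A)

theorem traceFunctional_apply (A : H →L[ℂ] H) (ρ : TraceClass H) :
    traceFunctional A ρ = opTrace (ρ.toCLM ∘L A) := rfl

theorem traceFunctional_rankOneOp (A : H →L[ℂ] H) (x y : H) :
    traceFunctional A (rankOneOp x y) = inner ℂ y (A x) :=
  opTrace_rankOne_comp x y A

/-- The lower bound needs only rank one operators of unit vectors, whose trace norm is at most 1 and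
on which the functional takes the matrix coefficients of `A`. -/
theorem norm_traceFunctional (A : H →L[ℂ] H) : ‖traceFunctional A‖ = ‖A‖ := by
  refine le_antisymm (LinearMap.mkContinuous_norm_le _ (norm_nonneg A) _) ?_
  refine A.opNorm_le_of_re_inner_le (norm_nonneg _) fun x y hx hy => ?_
  have h1 : ‖inner ℂ y (A x)‖ ≤ ‖traceFunctional A‖ := by
    rw [← traceFunctional_rankOneOp]
    refine ((traceFunctional A).le_opNorm _).trans (mul_le_of_le_one_right (norm_nonneg _) ?_)
    simpa [hx, hy] using norm_rankOneOp_le x y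
  rw [norm_inner_symm] at h1
  exact (RCLike.re_le_norm _).trans h1

/-- The values of `Φ` on rank one operators form a bounded sesquilinear form, hence come from a
bounded operator; trace-norm convergence of nuclear expansions extends the agreement to every `ρ`.
The adjoint appears because the form puts its operator in the first slot of the inner product. -/
theorem traceFunctional_surjective :
    Function.Surjective (traceFunctional : (H →L[ℂ] H) → StrongDual ℂ (TraceClass H)) := by
  intro Φ
  let B : H →L⋆[ℂ] H →L[ℂ] ℂ := LinearMap.mkContinuous₂
    (LinearMap.mk₂'ₛₗ (starRingEnd ℂ) (RingHom.id ℂ) (fun y x => Φ (rankOneOp x y))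
      (fun y y' x => by
        rw [← map_add]; congr 1; exact ext_toCLM (by simp [toCLM_add, toCLM_rankOneOp]))
      (fun r y x => by
        rw [← map_smul]; congr 1; exact ext_toCLM (by simp [toCLM_smul, toCLM_rankOneOp]))
      (fun y x x' => by
        rw [← map_add]; congr 1; exact ext_toCLM (by simp [toCLM_add, toCLM_rankOneOp]))
      (fun r y x => by
        rw [← map_smul]; congr 1; exact ext_toCLM (by simp [toCLM_smul, toCLM_rankOneOp])))
    ‖Φ‖ fun y x => by
      refine (Φ.le_opNorm _).trans ?_
      rw [mul_assoc, mul_comm ‖y‖]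
      gcongr
      exact norm_rankOneOp_le x y
  refine ⟨ContinuousLinearMap.adjoint (continuousLinearMapOfBilin B), ?_⟩
  refine ContinuousLinearMap.ext fun ρ => ?_
  obtain ⟨x, y, h⟩ := ρ.2
  have h' := hasSum_rankOneOp (T := ρ) h
  refine HasSum.unique ((traceFunctional _).hasSum h') ?_
  have key : ∀ x y, traceFunctional (ContinuousLinearMap.adjoint (continuousLinearMapOfBilin B))
      (rankOneOp x y) = Φ (rankOneOp x y) := fun x y => by
    rw [traceFunctional_rankOneOp, ContinuousLinearMap.adjoint_inner_right,
      continuousLinearMapOfBilin_apply]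
    rfl
  simp only [key]
  exact Φ.hasSum h'

variable (H) in
/-- The bounded operators are the dual of the trace class operators. -/
def traceDual : (H →L[ℂ] H) ≃ₗᵢ[ℂ] StrongDual ℂ (TraceClass H) :=
  LinearIsometryEquiv.ofSurjective
    { toFun := traceFunctional
      map_add' := fun A B => ContinuousLinearMap.ext fun ρ => opTrace_eq_of_hasSum fun s b => by
        simpa [inner_add_right, traceFunctional_apply] using (ρ.hasSum_inner A b).add (ρ.hasSum_inner B b)
      map_smul' := fun r A => ContinuousLinearMap.ext fun ρ => opTrace_eq_of_hasSum fun s b => by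
        simpa [inner_smul_right, traceFunctional_apply] using (ρ.hasSum_inner A b).mul_left r
      norm_map' := norm_traceFunctional } traceFunctional_surjective

theorem traceDual_apply (A : H →L[ℂ] H) (ρ : TraceClass H) :
    traceDual H A ρ = opTrace (ρ.toCLM ∘L A) := rfl

theorem isWStarRepresentation_id :
    IsWStarRepresentation (traceDual H) (NonUnitalStarAlgHom.id ℂ (H →L[ℂ] H)) :=
  @continuous_id _ (sigmaTopology fun A (ρ : TraceClass H) => opTrace (ρ.toCLM ∘L A))

end TraceClass

/-- The matrix coefficients of a W*-representation belong to the predual. -/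
theorem IsWStarRepresentation.exists_predual {M X : Type*} [CStarAlgebra M]
    [NormedAddCommGroup X] [NormedSpace ℂ X] {e : M ≃ₗᵢ[ℂ] StrongDual ℂ X}
    {φ : M →⋆ₙₐ[ℂ] (H →L[ℂ] H)} (hφ : IsWStarRepresentation e φ) (v w : H) :
    ∃ b : X, ∀ x : M, inner ℂ w (φ x v) = e x b := by
  let B : M →ₗ[ℂ] X →ₗ[ℂ] ℂ :=
    ContinuousLinearMap.coeLM ℂ ∘ₗ e.toLinearEquiv.toLinearMap
  have hB : ∀ x b, B x b = e x b := fun _ _ => rfl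
  let f : WeakBilin B →ₗ[ℂ] ℂ :=
    { toFun := fun x => inner ℂ w (φ (show M from x) v)
      map_add' := fun x y => by
        rw [← inner_add_right, ← add_apply, ← map_add]; rfl
      map_smul' := fun r x => by
        rw [RingHom.id_apply, smul_eq_mul, ← inner_smul_right, ← smul_apply, ← map_smul]; rfl }
  have hf : Continuous f := by
    have h1 : @Continuous (H →L[ℂ] H) ℂ
        (sigmaTopology fun A (ρ : TraceClass H) => opTrace (ρ.toCLM ∘L A)) _
        fun A => inner ℂ w (A v) := by
      have h2 : (fun A : H →L[ℂ] H => inner ℂ w (A v)) =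
          (fun g : TraceClass H → ℂ => g (TraceClass.rankOneOp v w)) ∘
            fun A ρ => opTrace (ρ.toCLM ∘L A) :=
        funext fun A => (opTrace_rankOne_comp v w A).symm
      rw [h2]
      exact @Continuous.comp _ _ _ (_) (_) (_) _ _ (continuous_apply _) continuous_induced_dom
    exact @Continuous.comp M (H →L[ℂ] H) ℂ (_) (_) (_) _ _ h1 hφ
  -- A linear functional continuous for the weak topology of a pairing is evaluation at an element
  -- of the other space.
  obtain ⟨b, hb⟩ := LinearMap.dualEmbedding_surjective B ⟨f, hf⟩
  exact ⟨b, fun x => (congrArg (fun g : WeakBilin B →L[ℂ] ℂ => g x) hb).symm⟩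

end TraceClassTheory

/-! ### W*-representations satisfy the semidirect conditions -/

section WStarSemidirect

variable {M : Type*} [CStarAlgebra M] {X : Type*} [NormedAddCommGroup X] [NormedSpace ℂ X]
  {e : M ≃ₗᵢ[ℂ] StrongDual ℂ X}
  {H : Type*} [NormedAddCommGroup H] [InnerProductSpace ℂ H] [CompleteSpace H]
  (φ : M →⋆ₙₐ[ℂ] (H →L[ℂ] H))

theorem isLieRepresentation_of_starAlgHom :
    IsLieRepresentation ℂ (fun (x : M) (v : H) => φ x v) where
  bounded :=
    { add_left := fun x y v => by rw [map_add]; rfl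
      smul_left := fun r x v => by rw [map_smul]; rfl
      add_right := fun x v w => map_add _ _ _
      smul_right := fun r x v => map_smul _ _ _
      bound := ⟨1, one_pos, fun x v => by
        rw [one_mul]
        refine ((φ x).le_opNorm v).trans ?_
        gcongr
        exact NonUnitalStarAlgHom.norm_apply_le φ x⟩ }
  map_lie x y v := by
    rw [Ring.lie_def, map_sub, map_mul, map_mul]; rfl

theorem isLieRepresentation_real_of_starAlgHom :
    IsLieRepresentation ℝ (fun (x : M) (v : H) => φ x v) where
  bounded :=
    { add_left := (isLieRepresentation_of_starAlgHom φ).bounded.add_left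
      smul_left := fun r x v => (isLieRepresentation_of_starAlgHom φ).bounded.smul_left (r : ℂ) x v
      add_right := (isLieRepresentation_of_starAlgHom φ).bounded.add_right
      smul_right := fun r x v =>
        (isLieRepresentation_of_starAlgHom φ).bounded.smul_right (r : ℂ) x v
      bound := (isLieRepresentation_of_starAlgHom φ).bounded.bound }
  map_lie := (isLieRepresentation_of_starAlgHom φ).map_lie

variable {φ} (hφ : IsWStarRepresentation e φ)
include hφ

theorem IsWStarRepresentation.semidirectConditions :
    SemidirectConditions (hilbertBidual H) e (fun (x : M) (v : H) => φ x v) where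
  left x ℓ := ⟨ℓ ∘L φ x, fun ζ => rfl⟩
  right ζ ℓ := by
    obtain ⟨w, rfl⟩ := (InnerProductSpace.toDual ℂ H).surjective ℓ
    exact hφ.exists_predual ζ w

theorem IsWStarRepresentation.semidirectConditions_real :
    SemidirectConditions (hilbertRealDual H) (realDual e) (fun (x : M) (v : H) => φ x v) where
  left x v := ⟨ContinuousLinearMap.adjoint (φ x) v, fun ζ => by
    rw [hilbertRealDual_apply, hilbertRealDual_apply, ContinuousLinearMap.adjoint_inner_right]⟩
  right ζ v := by
    obtain ⟨b, hb⟩ := hφ.exists_predual ζ v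
    refine ⟨b, fun x => ?_⟩
    rw [hilbertRealDual_apply, realDual_apply, ← hb, ← inner_conj_symm, Complex.conj_re]

omit hφ in
/-- The coadjoint action of a W*-algebra preserves the predual. -/
theorem exists_predual_lie [CompleteSpace X] (e : M ≃ₗᵢ[ℂ] StrongDual ℂ X) (a : M) (b : X) :
    ∃ b' : X, ∀ x, e ⁅x, a⁆ b = e x b' := by
  obtain ⟨b₁, h₁⟩ := exists_predual_mul_right e a b
  obtain ⟨b₂, h₂⟩ := exists_predual_mul_left e a b
  refine ⟨b₁ - b₂, fun x => ?_⟩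
  rw [Ring.lie_def, map_sub, map_sub, sub_apply, h₁, h₂]

theorem IsWStarRepresentation.exists_isSemidirectLiePoisson [CompleteSpace X] :
    ∃ P : PoissonStructure ℂ (StrongDual ℂ H × X),
      IsSemidirectLiePoisson (hilbertBidual H) e (fun (x : M) (v : H) => φ x v) P :=
  _root_.exists_isSemidirectLiePoisson _ _ (isLieRepresentation_of_starAlgHom φ)
    hφ.semidirectConditions (exists_predual_lie e)

theorem IsWStarRepresentation.exists_isSemidirectLiePoisson_real [CompleteSpace X] :
    ∃ P : PoissonStructure ℝ (H × X),
      IsSemidirectLiePoisson (hilbertRealDual H) (realDual e)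
        (fun (x : M) (v : H) => φ x v) P :=
  _root_.exists_isSemidirectLiePoisson _ _ (isLieRepresentation_real_of_starAlgHom φ)
    hφ.semidirectConditions_real fun a b => by
      obtain ⟨b', hb'⟩ := exists_predual_lie e a b
      exact ⟨b', fun x => congrArg Complex.re (hb' x)⟩

end WStarSemidirect

/-! ### Hamilton's equations -/

section Hamilton

/-- A differentiable curve has the velocity `X` if all smooth functions evolve along `X`. -/
theorem forall_smoothFun_hasDerivAt_iff {𝕜 : Type*} [RCLike 𝕜] {E : Type*} [NormedAddCommGroup E]
    [NormedSpace 𝕜 E] [NormedSpace ℝ E] [IsScalarTower ℝ 𝕜 E] {z : ℝ → E} {t : ℝ}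
    (hz : DifferentiableAt ℝ z t) (X : E) :
    (∀ f : SmoothFun 𝕜 E, HasDerivAt (fun s => f.1 (z s)) (fderiv 𝕜 f.1 (z t) X) t) ↔
      HasDerivAt z X t := by
  have hcomp : ∀ (f : SmoothFun 𝕜 E) (w : E), HasDerivAt z w t →
      HasDerivAt (fun s => f.1 (z s)) (fderiv 𝕜 f.1 (z t) w) t := fun f w hw =>
    ((SmoothFun.differentiable f (z t)).hasFDerivAt.restrictScalars ℝ).comp_hasDerivAt t hw
  refine ⟨fun h => ?_, fun h f => hcomp f X h⟩
  have : deriv z t = X := by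
    -- Linear functionals are smooth and separate points, so they already determine the velocity.
    refine (SeparatingDual.eq_iff_forall_dual_eq (R := 𝕜)).mpr fun ℓ => ?_
    have := (hcomp (SmoothFun.ofDual ℓ) _ hz.hasDerivAt).unique (h (SmoothFun.ofDual ℓ))
    rwa [SmoothFun.fderiv_ofDual] at this
  exact this ▸ hz.hasDerivAt

variable {H : Type*} [NormedAddCommGroup H] [InnerProductSpace ℂ H] [CompleteSpace H]

omit [CompleteSpace H] in
theorem ext_re_inner_left {v w : H} (h : ∀ u : H, (inner ℂ u v).re = (inner ℂ u w).re) :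
    v = w := by
  have h1 := h (v - w)
  rw [← sub_eq_zero, ← Complex.sub_re, ← inner_sub_right] at h1
  rw [← sub_eq_zero]
  exact inner_self_eq_zero.mp (Complex.ext h1 (inner_self_im (𝕜 := ℂ) (v - w)))

namespace TraceClass

theorem traceDual_rankOne (x y : H) (ρ : TraceClass H) :
    traceDual H (InnerProductSpace.rankOne ℂ x y) ρ = inner ℂ y (ρ.toCLM x) := by
  rw [traceDual_apply, InnerProductSpace.comp_rankOne, opTrace_rankOne]

theorem traceDual_mul_rankOne (A : H →L[ℂ] H) (x y : H) (ρ : TraceClass H) :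
    traceDual H (A * InnerProductSpace.rankOne ℂ x y) ρ = inner ℂ y (ρ.toCLM (A x)) := by
  rw [ContinuousLinearMap.mul_def, InnerProductSpace.comp_rankOne, traceDual_rankOne]

theorem traceDual_rankOne_mul (A : H →L[ℂ] H) (x y : H) (ρ : TraceClass H) :
    traceDual H (InnerProductSpace.rankOne ℂ x y * A) ρ = inner ℂ y (A (ρ.toCLM x)) := by
  rw [traceDual_apply, ContinuousLinearMap.mul_def, ← ContinuousLinearMap.comp_assoc,
    InnerProductSpace.comp_rankOne, opTrace_rankOne_comp]

/-- Rank one test operators `B` turn the trace identity into matrix entries. Real parts suffice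
since the test vectors range over a complex space, so one lemma serves both settings. -/
theorem toCLM_eq_lie_add_rankOne {A : H →L[ℂ] H} {ρ Z : TraceClass H} {δ v : H}
    (h : ∀ B : H →L[ℂ] H, (traceDual H B Z).re =
      (inner ℂ v (B δ)).re - (traceDual H ⁅A, B⁆ ρ).re) :
    Z.toCLM = ⁅A, ρ.toCLM⁆ + InnerProductSpace.rankOne ℂ δ v := by
  refine ContinuousLinearMap.ext fun x => ext_re_inner_left fun y => ?_
  have h1 := h (InnerProductSpace.rankOne ℂ x y)
  rw [traceDual_rankOne, Ring.lie_def, map_sub, sub_apply, traceDual_mul_rankOne,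
    traceDual_rankOne_mul, InnerProductSpace.rankOne_apply, inner_smul_right] at h1
  rw [h1, Ring.lie_def, add_apply, sub_apply, InnerProductSpace.rankOne_apply, inner_add_right,
    inner_sub_right, inner_smul_right, mul_comm (inner ℂ v x)]
  simp only [Complex.add_re, Complex.sub_re, mul_apply_eq_comp]
  ring

end TraceClass

variable (H) in
/-- The Riesz map as a real-linear map. -/
def toDualRealCLM : H →L[ℝ] StrongDual ℂ H :=
  LinearMap.mkContinuous
    { toFun := fun v => InnerProductSpace.toDual ℂ H v
      map_add' := fun v w => map_add _ v w
      map_smul' := fun r v => by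
        change InnerProductSpace.toDual ℂ H ((r : ℂ) • v) =
          (r : ℂ) • InnerProductSpace.toDual ℂ H v
        rw [map_smulₛₗ, Complex.conj_ofReal] } 1
    fun v => by
      rw [one_mul]
      exact ((InnerProductSpace.toDual ℂ H).norm_map v).le

theorem hasDerivAt_toDual {v : ℝ → H} {v' : H} {t : ℝ} (hv : HasDerivAt v v' t) :
    HasDerivAt (fun s => InnerProductSpace.toDual ℂ H (v s)) (InnerProductSpace.toDual ℂ H v') t :=
  (toDualRealCLM H).hasFDerivAt.comp_hasDerivAt t hv

theorem hasDerivAt_prod_iff {E F : Type*} [NormedAddCommGroup E] [NormedSpace ℝ E]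
    [NormedAddCommGroup F] [NormedSpace ℝ F] {u : ℝ → E} {w : ℝ → F} {t : ℝ} {p : E × F} :
    HasDerivAt (fun s => (u s, w s)) p t ↔ HasDerivAt u p.1 t ∧ HasDerivAt w p.2 t :=
  ⟨fun h => ⟨(ContinuousLinearMap.fst ℝ E F).hasFDerivAt.comp_hasDerivAt t h,
    (ContinuousLinearMap.snd ℝ E F).hasFDerivAt.comp_hasDerivAt t h⟩, fun h => h.1.prodMk h.2⟩

theorem hasDerivAt_toDual_iff {v : ℝ → H} {v' : H} {t : ℝ} (hv : DifferentiableAt ℝ v t) :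
    HasDerivAt (fun s => InnerProductSpace.toDual ℂ H (v s)) (InnerProductSpace.toDual ℂ H v') t ↔
      HasDerivAt v v' t := by
  refine ⟨fun h => ?_, hasDerivAt_toDual⟩
  have := (InnerProductSpace.toDual ℂ H).injective
    ((hasDerivAt_toDual hv.hasDerivAt).unique h)
  exact this ▸ hv.hasDerivAt

omit [CompleteSpace H] in
theorem TraceClass.hasDerivAt_iff_exists {ρ : ℝ → TraceClass H} {Z : TraceClass H} {t : ℝ} :
    HasDerivAt ρ Z t ↔ ∃ ρ' : TraceClass H, HasDerivAt ρ ρ' t ∧ ρ'.toCLM = Z.toCLM :=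
  ⟨fun h => ⟨Z, h, rfl⟩, fun ⟨_, h, h'⟩ => TraceClass.ext_toCLM h' ▸ h⟩

theorem IsSemidirectLiePoisson.bracket_traceClass
    {P : PoissonStructure ℂ (StrongDual ℂ H × TraceClass H)}
    (hP : IsSemidirectLiePoisson (hilbertBidual H) (TraceClass.traceDual H)
      (fun (A : H →L[ℂ] H) (v : H) => A v) P)
    (f g : SmoothFun ℂ (StrongDual ℂ H × TraceClass H)) (v : H) (ρ : TraceClass H) :
    let z := (InnerProductSpace.toDual ℂ H v, ρ)
    (P.bracket f g).1 z =
      opTrace (ρ.toCLM ∘L ⁅derivSnd (TraceClass.traceDual H) f z,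
        derivSnd (TraceClass.traceDual H) g z⁆) +
      inner ℂ v (derivSnd (TraceClass.traceDual H) f z (derivFst (hilbertBidual H) g z) -
        derivSnd (TraceClass.traceDual H) g z (derivFst (hilbertBidual H) f z)) :=
  hP.bracket_eq f g _

theorem IsSemidirectLiePoisson.hamilton_traceClass
    {P : PoissonStructure ℂ (StrongDual ℂ H × TraceClass H)}
    (hP : IsSemidirectLiePoisson (hilbertBidual H) (TraceClass.traceDual H)
      (fun (A : H →L[ℂ] H) (v : H) => A v) P)
    (h : SmoothFun ℂ (StrongDual ℂ H × TraceClass H)) (v : ℝ → H) (ρ : ℝ → TraceClass H) (t : ℝ)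
    (hv : DifferentiableAt ℝ v t) (hρ : DifferentiableAt ℝ ρ t) :
    let z := fun s => (InnerProductSpace.toDual ℂ H (v s), ρ s)
    ((∀ f : SmoothFun ℂ (StrongDual ℂ H × TraceClass H),
        HasDerivAt (fun s => f.1 (z s)) ((P.bracket f h).1 (z t)) t) ↔
      HasDerivAt v (-(ContinuousLinearMap.adjoint
        (derivSnd (TraceClass.traceDual H) h (z t)) (v t))) t ∧
      ∃ ρ' : TraceClass H, HasDerivAt ρ ρ' t ∧
        ρ'.toCLM = ⁅derivSnd (TraceClass.traceDual H) h (z t), (ρ t).toCLM⁆ +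
          InnerProductSpace.rankOne ℂ (derivFst (hilbertBidual H) h (z t)) (v t)) := by
  intro z
  obtain ⟨X, -, hX, hXd⟩ := hP.vectorField h
  obtain ⟨h1, h2⟩ := hXd (z t)
  have hz : DifferentiableAt ℝ z t :=
    ((hasDerivAt_toDual hv.hasDerivAt).prodMk hρ.hasDerivAt).differentiableAt
  -- The predual component of the field is a functional on `H`; its Riesz vector gives the velocity
  -- of `v`. The Riesz map is antilinear, but real-linearity is enough for differentiation in `t`.
  have hX1 : (X (z t)).1 = InnerProductSpace.toDual ℂ H
      (-(ContinuousLinearMap.adjoint (derivSnd (TraceClass.traceDual H) h (z t)) (v t))) := by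
    refine ContinuousLinearMap.ext fun ζ => (h1 ζ).trans ?_
    rw [InnerProductSpace.toDual_apply_apply, inner_neg_left,
      ContinuousLinearMap.adjoint_inner_left]
    rfl
  have hX2 := TraceClass.toCLM_eq_lie_add_rankOne (Z := (X (z t)).2) (ρ := ρ t)
    (A := derivSnd (TraceClass.traceDual H) h (z t))
    (δ := derivFst (hilbertBidual H) h (z t)) (v := v t) fun B => by
      rw [h2 B, Complex.sub_re]
      rfl
  simp only [hX]
  have : IsScalarTower ℝ ℂ (StrongDual ℂ H) := inferInstance
  have : IsScalarTower ℝ ℂ (TraceClass H) := inferInstance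
  have : IsScalarTower ℝ ℂ (StrongDual ℂ H × TraceClass H) := Prod.isScalarTower
  rw [forall_smoothFun_hasDerivAt_iff hz, hasDerivAt_prod_iff, hX1, hasDerivAt_toDual_iff hv,
    TraceClass.hasDerivAt_iff_exists (Z := (X (z t)).2), hX2]

theorem IsSemidirectLiePoisson.bracket_traceClass_real
    {P : PoissonStructure ℝ (H × TraceClass H)}
    (hP : IsSemidirectLiePoisson (hilbertRealDual H) (realDual (TraceClass.traceDual H))
      (fun (A : H →L[ℂ] H) (v : H) => A v) P)
    (f g : SmoothFun ℝ (H × TraceClass H)) (v : H) (ρ : TraceClass H) :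
    let z := (v, ρ)
    (P.bracket f g).1 z =
      (opTrace (ρ.toCLM ∘L ⁅derivSnd (realDual (TraceClass.traceDual H)) f z,
        derivSnd (realDual (TraceClass.traceDual H)) g z⁆) +
      inner ℂ v (derivSnd (realDual (TraceClass.traceDual H)) f z
          (derivFst (hilbertRealDual H) g z) -
        derivSnd (realDual (TraceClass.traceDual H)) g z
          (derivFst (hilbertRealDual H) f z))).re := by
  intro z
  rw [hP.bracket_eq f g z, Complex.add_re, hilbertRealDual_apply, ← inner_conj_symm,
    Complex.conj_re]
  rfl

theorem IsSemidirectLiePoisson.hamilton_traceClass_real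
    {P : PoissonStructure ℝ (H × TraceClass H)}
    (hP : IsSemidirectLiePoisson (hilbertRealDual H) (realDual (TraceClass.traceDual H))
      (fun (A : H →L[ℂ] H) (v : H) => A v) P)
    (h : SmoothFun ℝ (H × TraceClass H)) (v : ℝ → H) (ρ : ℝ → TraceClass H) (t : ℝ)
    (hv : DifferentiableAt ℝ v t) (hρ : DifferentiableAt ℝ ρ t) :
    let z := fun s => (v s, ρ s)
    ((∀ f : SmoothFun ℝ (H × TraceClass H),
        HasDerivAt (fun s => f.1 (z s)) ((P.bracket f h).1 (z t)) t) ↔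
      HasDerivAt v (-(ContinuousLinearMap.adjoint
        (derivSnd (realDual (TraceClass.traceDual H)) h (z t)) (v t))) t ∧
      ∃ ρ' : TraceClass H, HasDerivAt ρ ρ' t ∧
        ρ'.toCLM = ⁅derivSnd (realDual (TraceClass.traceDual H)) h (z t), (ρ t).toCLM⁆ +
          InnerProductSpace.rankOne ℂ (derivFst (hilbertRealDual H) h (z t)) (v t)) := by
  intro z
  obtain ⟨X, -, hX, hXd⟩ := hP.vectorField h
  obtain ⟨h1, h2⟩ := hXd (z t)
  have hz : DifferentiableAt ℝ z t := (hv.hasDerivAt.prodMk hρ.hasDerivAt).differentiableAt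
  have hX1 : (X (z t)).1 =
      -(ContinuousLinearMap.adjoint
        (derivSnd (realDual (TraceClass.traceDual H)) h (z t)) (v t)) := by
    refine ext_re_inner_left fun ζ => (h1 ζ).trans ?_
    rw [inner_neg_right, ContinuousLinearMap.adjoint_inner_right]
    rfl
  have hX2 := TraceClass.toCLM_eq_lie_add_rankOne (Z := (X (z t)).2) (ρ := ρ t)
    (A := derivSnd (realDual (TraceClass.traceDual H)) h (z t))
    (δ := derivFst (hilbertRealDual H) h (z t)) (v := v t) fun B => by
      refine (h2 B).trans ?_
      rw [hilbertRealDual_apply, ← inner_conj_symm, Complex.conj_re]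
      rfl
  simp only [hX]
  rw [forall_smoothFun_hasDerivAt_iff hz, hasDerivAt_prod_iff, hX1,
    TraceClass.hasDerivAt_iff_exists (Z := (X (z t)).2), hX2]

end Hamilton

end

theorem mainTheorem9
    -- a W*-algebra `M` with predual `X`, and a W*-representation on a complex Hilbert space `H`
    {M : Type*} [CStarAlgebra M]
    {X : Type*} [NormedAddCommGroup X] [NormedSpace ℂ X] [CompleteSpace X]
    (e : M ≃ₗᵢ[ℂ] StrongDual ℂ X)
    {H : Type*} [NormedAddCommGroup H] [InnerProductSpace ℂ H] [CompleteSpace H]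
    (φ : M →⋆ₙₐ[ℂ] (H →L[ℂ] H)) (hφ : IsWStarRepresentation e φ) :
    IsLieRepresentation ℂ (fun (x : M) (v : H) => φ x v) ∧
    (∀ v w : H, ∃ b : X, ∀ x : M, inner ℂ w (φ x v) = e x b) ∧
    -- complex (holomorphic) version: `H` is identified with its predual by `v ↦ ⟪v, ·⟫`
    SemidirectConditions (hilbertBidual H) e (fun (x : M) (v : H) => φ x v) ∧
    (∃! P : PoissonStructure ℂ (StrongDual ℂ H × X),
      IsSemidirectLiePoisson (hilbertBidual H) e (fun (x : M) (v : H) => φ x v) P) ∧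
    -- real smooth version: pairings are the real parts of the complex ones
    SemidirectConditions (hilbertRealDual H) (realDual e) (fun (x : M) (v : H) => φ x v) ∧
    (∃! P : PoissonStructure ℝ (H × X),
      IsSemidirectLiePoisson (hilbertRealDual H) (realDual e)
        (fun (x : M) (v : H) => φ x v) P) ∧
    -- the case `M = L^∞(H)`: its predual is the Banach space `L¹(H)` with the trace pairing
    CompleteSpace (TraceClass H) ∧
    ∃ tr : (H →L[ℂ] H) ≃ₗᵢ[ℂ] StrongDual ℂ (TraceClass H),
      (∀ (A : H →L[ℂ] H) (ρ : TraceClass H), tr A ρ = opTrace (ρ.toCLM ∘L A)) ∧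
      (∀ (A : H →L[ℂ] H) (ρ : TraceClass H) (s : Set H) (b : HilbertBasis s ℂ H),
        HasSum (fun i => inner ℂ (b i) (ρ.toCLM (A (b i)))) (tr A ρ)) ∧
      IsWStarRepresentation tr (NonUnitalStarAlgHom.id ℂ (H →L[ℂ] H)) ∧
      -- complex version
      (∃ P : PoissonStructure ℂ (StrongDual ℂ H × TraceClass H),
        IsSemidirectLiePoisson (hilbertBidual H) tr (fun (A : H →L[ℂ] H) (v : H) => A v) P ∧
        (∀ (f g : SmoothFun ℂ (StrongDual ℂ H × TraceClass H)) (v : H) (ρ : TraceClass H),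
          let z := (InnerProductSpace.toDual ℂ H v, ρ)
          (P.bracket f g).1 z =
            opTrace (ρ.toCLM ∘L ⁅derivSnd tr f z, derivSnd tr g z⁆) +
            inner ℂ v (derivSnd tr f z (derivFst (hilbertBidual H) g z) -
              derivSnd tr g z (derivFst (hilbertBidual H) f z))) ∧
        (∀ (h : SmoothFun ℂ (StrongDual ℂ H × TraceClass H)) (v : ℝ → H) (ρ : ℝ → TraceClass H)
          (t : ℝ), DifferentiableAt ℝ v t → DifferentiableAt ℝ ρ t →
          let z := fun s => (InnerProductSpace.toDual ℂ H (v s), ρ s)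
          ((∀ f : SmoothFun ℂ (StrongDual ℂ H × TraceClass H),
              HasDerivAt (fun s => f.1 (z s)) ((P.bracket f h).1 (z t)) t) ↔
            HasDerivAt v (-(ContinuousLinearMap.adjoint (derivSnd tr h (z t)) (v t))) t ∧
            ∃ ρ' : TraceClass H, HasDerivAt ρ ρ' t ∧
              ρ'.toCLM = ⁅derivSnd tr h (z t), (ρ t).toCLM⁆ +
                InnerProductSpace.rankOne ℂ (derivFst (hilbertBidual H) h (z t)) (v t)))) ∧
      -- real version
      (∃ P : PoissonStructure ℝ (H × TraceClass H),
        IsSemidirectLiePoisson (hilbertRealDual H) (realDual tr)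
          (fun (A : H →L[ℂ] H) (v : H) => A v) P ∧
        (∀ (f g : SmoothFun ℝ (H × TraceClass H)) (v : H) (ρ : TraceClass H),
          let z := (v, ρ)
          (P.bracket f g).1 z =
            (opTrace (ρ.toCLM ∘L ⁅derivSnd (realDual tr) f z, derivSnd (realDual tr) g z⁆) +
            inner ℂ v (derivSnd (realDual tr) f z (derivFst (hilbertRealDual H) g z) -
              derivSnd (realDual tr) g z (derivFst (hilbertRealDual H) f z))).re) ∧
        (∀ (h : SmoothFun ℝ (H × TraceClass H)) (v : ℝ → H) (ρ : ℝ → TraceClass H)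
          (t : ℝ), DifferentiableAt ℝ v t → DifferentiableAt ℝ ρ t →
          let z := fun s => (v s, ρ s)
          ((∀ f : SmoothFun ℝ (H × TraceClass H),
              HasDerivAt (fun s => f.1 (z s)) ((P.bracket f h).1 (z t)) t) ↔
            HasDerivAt v (-(ContinuousLinearMap.adjoint (derivSnd (realDual tr) h (z t)) (v t))) t ∧
            ∃ ρ' : TraceClass H, HasDerivAt ρ ρ' t ∧
              ρ'.toCLM = ⁅derivSnd (realDual tr) h (z t), (ρ t).toCLM⁆ +
                InnerProductSpace.rankOne ℂ (derivFst (hilbertRealDual H) h (z t)) (v t)))) := by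
  have hid := TraceClass.isWStarRepresentation_id (H := H)
  refine ⟨isLieRepresentation_of_starAlgHom φ, hφ.exists_predual, hφ.semidirectConditions, ?_,
    hφ.semidirectConditions_real, ?_, inferInstance, TraceClass.traceDual H,
    TraceClass.traceDual_apply, fun A ρ s b => ρ.hasSum_inner A b, hid, ?_, ?_⟩
  · obtain ⟨P, hP⟩ := hφ.exists_isSemidirectLiePoisson
    exact ⟨P, hP, fun Q hQ => hQ.unique hP⟩
  · obtain ⟨P, hP⟩ := hφ.exists_isSemidirectLiePoisson_real
    exact ⟨P, hP, fun Q hQ => hQ.unique hP⟩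
  · obtain ⟨P, hP⟩ := hid.exists_isSemidirectLiePoisson
    exact ⟨P, hP, hP.bracket_traceClass, hP.hamilton_traceClass⟩
  · obtain ⟨P, hP⟩ := hid.exists_isSemidirectLiePoisson_real
    exact ⟨P, hP, hP.bracket_traceClass_real, hP.hamilton_traceClass_real⟩
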